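/- Let $\Phi$ be the class of convex functions $\phi:[0,\infty)\to\mathbb R\cup\{\infty\}$, differentiable on $(0,\infty)$, with $\phi(1)=\phi'(1)=0$ and $\phi''(1)>0$, and for nonnegative vectors let $D_\phi(a,b)=\sum_{i=1}^k b_i\,\phi(a_i/b_i)$, with $0\,\phi(0/0)=0$ and $0\,\phi(p/0)=p\lim_{u\to\infty}\phi(u)/u$. Let $X$ be a $k\times t$ matrix of rank $t$ and $m(\theta)=\exp(X\theta)$ (componentwise), $\theta\in\mathbb R^t$. Let $c\ge 0$. If $c\ge1$, the $k$ cells are partitioned into $c$ subtables and $X_0$ is the $k\times c$ matrix whose columns are the indicator vectors of the subtables, with $\mathcal C(X_0)\subset\mathcal C(X)$ (column spaces); if $c=0$, $X_0$ is absent. Let $C$ be a $k\times r$ matrix, $r\ge0$, and $L=(X_0,C)$. For a table $n\in\mathbb N^k$ and $d^*\in\mathbb R^r$ put $d=(n^TX_0,(d^*)^T)^T$ and $\Theta=\{\theta\in\mathbb R^t: L^Tm(\theta)=d\}$. A minimum $\phi$-divergence estimator is a function $\hat\theta^{\phi}=\hat\theta^\phi(n)$ that is a minimizer of $\theta\mapsto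 D_\phi(n,m(\theta))$ over $\Theta$ whenever a minimizer exists. Consider a sequence of such models, with $X$, $X_0$, $C$ fixed, in which the null hypothesis (the loglinear model with linear constraints) holds: the mean vector of the table $n$ is $m(\theta_0)$ with $C^Tm(\theta_0)=d^*$ (where $\theta_0$ and $d^*$ may vary along the sequence); if $c\ge 1$, the prefixed subtable totals are the entries of $X_0^Tm(\theta_0)$, which are integers; the counts $n_1,\dots,n_k$ are independent Poisson variables with means $m_i(\theta_0)$, conditioned, if $c\ge1$, on $X_0^Tn=X_0^Tm(\theta_0)$ (that is, Poisson, multinomial or product-multinomial sampling according as $c=0$, $c=1$ or $c\ge2$). Suppose that $N=\sum_i m_i(\theta_0)\to\infty$ along the sequence while $m^*=m(\theta_0)/N$ remains fixed, and that the $t\times(c+r)$ matrix $X^T\operatorname{diag}(m^*)L$ has rank $c+r$ (in particular $\operatorname{rank}L=c+r\le t$). Then for all $\phi_1,\phi_2\in\Phi$ the goodness-of-fit statistic $$T^{\phi_1}(\hat\theta^{\phi_2})=\frac{2}{\phi_1''(1)}\,D_{\phi_1}\bigl(n,m(\hat\theta^{\phi_2})\bigr)$$ converges in distribution, as $N\to\infty$,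 to the chi-squared distribution with $k-t+r$ degrees of freedom (the point mass at $0$ if $k-t+r=0$). -/

import Mathlib

open MeasureTheory ProbabilityTheory Filter Topology Matrix

noncomputable section

namespace LMLC

/-- The class `Φ` of convex differentiable functions `φ : [0, ∞) → ℝ ∪ {∞}` with
`φ(1) = φ'(1) = 0` and `φ''(1) > 0`. Only the values on `[0, ∞)` are relevant. Differentiability
is required on `(0, ∞)`, where `φ` is therefore finite; `φ(0) = ∞` is allowed. -/
structure IsPhi (φ : ℝ → EReal) : Prop where
  ne_bot : ∀ x, 0 ≤ x → φ x ≠ ⊥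
  ne_top : ∀ x, 0 < x → φ x ≠ ⊤
  convex : ∀ x y a b : ℝ, 0 ≤ x → 0 ≤ y → 0 < a → 0 < b → a + b = 1 →
    φ (a * x + b * y) ≤ (a : EReal) * φ x + (b : EReal) * φ y
  differentiable : ∀ x, 0 < x → DifferentiableAt ℝ (fun y => (φ y).toReal) x
  map_one : φ 1 = 0
  deriv_one : deriv (fun y => (φ y).toReal) 1 = 0
  deriv_two_one : 0 < deriv (deriv (fun y => (φ y).toReal)) 1

/-- The number `φ''(1)`. -/
def phiSecond (φ : ℝ → EReal) : ℝ := deriv (deriv (fun y => (φ y).toReal)) 1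

/-- One summand `b φ(a / b)` of a `φ`-divergence, with the conventions `0 φ(0 / 0) = 0` and
`0 φ(p / 0) = p lim_{u → ∞} φ(u) / u`. -/
def phiTerm (φ : ℝ → EReal) (a b : ℝ) : EReal :=
  if b = 0 then
    if a = 0 then 0 else (a : EReal) * limsup (fun u : ℝ => φ u / (u : EReal)) atTop
  else (b : EReal) * φ (a / b)

/-- The `φ`-divergence `D_φ(a, b)` between two nonnegative vectors. -/
def phiDiv (φ : ℝ → EReal) {k : ℕ} (a b : Fin k → ℝ) : EReal := ∑ i, phiTerm φ (a i) (b i)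

/-- The mean vector of the loglinear model: `log m(θ) = X θ`. -/
def meanVec {k t : ℕ} (X : Matrix (Fin k) (Fin t) ℝ) (θ : Fin t → ℝ) : Fin k → ℝ :=
  fun i => Real.exp ((X *ᵥ θ) i)

/-- The matrix of the sampling constraints. For `c = 0` (Poisson sampling) it has no columns. For
`c ≥ 1` (multinomial or product-multinomial sampling) the cells are split into `c` subtables, cell
`i` belonging to subtable `block _ i`, and column `h` is the indicator vector of subtable `h`. -/
def samplingMatrix {k c : ℕ} (block : 0 < c → Fin k → Fin c) : Matrix (Fin k) (Fin c) ℝ :=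
  Matrix.of fun i h => if block (Fin.pos h) i = h then 1 else 0

/-- The table of counts as a real vector. -/
def realTable {k : ℕ} (n : Fin k → ℕ) : Fin k → ℝ := fun i => (n i : ℝ)

/-- `L = (X₀, C)`. -/
def constraintMatrix {k c r : ℕ} (X0 : Matrix (Fin k) (Fin c) ℝ) (C : Matrix (Fin k) (Fin r) ℝ) :
    Matrix (Fin k) (Fin c ⊕ Fin r) ℝ :=
  Matrix.fromCols X0 C

/-- The parameter space `Θ = {θ : Lᵀ m(θ) = d}`, with `L = (X₀, C)` and `d = (nᵀ X₀, d*ᵀ)ᵀ`. -/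
def paramSpace {k t c r : ℕ} (X : Matrix (Fin k) (Fin t) ℝ) (X0 : Matrix (Fin k) (Fin c) ℝ)
    (C : Matrix (Fin k) (Fin r) ℝ) (dstar : Fin r → ℝ) (n : Fin k → ℕ) : Set (Fin t → ℝ) :=
  {θ | (constraintMatrix X0 C)ᵀ *ᵥ meanVec X θ = Sum.elim (X0ᵀ *ᵥ realTable n) dstar}

/-- `θ` attains the minimum of `D_φ(n, m(·))` over the parameter space. -/
def IsPhiMinimizer {k t c r : ℕ} (φ : ℝ → EReal) (X : Matrix (Fin k) (Fin t) ℝ)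
    (X0 : Matrix (Fin k) (Fin c) ℝ) (C : Matrix (Fin k) (Fin r) ℝ) (dstar : Fin r → ℝ)
    (n : Fin k → ℕ) (θ : Fin t → ℝ) : Prop :=
  θ ∈ paramSpace X X0 C dstar n ∧
    IsMinOn (fun θ' => phiDiv φ (realTable n) (meanVec X θ')) (paramSpace X X0 C dstar n) θ

/-- `θhat` is a minimum `φ`-divergence estimator: for every table `n` for which a minimizer exists,
`θhat n` is one (its value on the other tables is arbitrary). -/
def IsMinPhiEstimator {k t c r : ℕ} (φ : ℝ → EReal) (X : Matrix (Fin k) (Fin t) ℝ)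
    (X0 : Matrix (Fin k) (Fin c) ℝ) (C : Matrix (Fin k) (Fin r) ℝ) (dstar : Fin r → ℝ)
    (θhat : (Fin k → ℕ) → Fin t → ℝ) : Prop :=
  ∀ n, (∃ θ, IsPhiMinimizer φ X X0 C dstar n θ) → IsPhiMinimizer φ X X0 C dstar n (θhat n)

/-- The law of the table: independent Poisson counts with mean vector `m`, given that the totals
prefixed by the sampling scheme take their prescribed values, `X₀ᵀ n = X₀ᵀ m`. For `c = 0` there is
no condition; for `c ≥ 1` this is the (product-)multinomial law. -/
def dataLaw {k c : ℕ} (X0 : Matrix (Fin k) (Fin c) ℝ) (m : Fin k → ℝ) : Measure (Fin k → ℕ) :=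
  ProbabilityTheory.cond (Measure.pi fun i => poissonMeasure (Real.toNNReal (m i)))
    {n | X0ᵀ *ᵥ realTable n = X0ᵀ *ᵥ m}

/-- The goodness-of-fit statistic `(2 / φ₁''(1)) D_{φ₁}(n, m(θ))`. -/
def testStat {k t : ℕ} (φ₁ : ℝ → EReal) (X : Matrix (Fin k) (Fin t) ℝ) (n : Fin k → ℕ)
    (θ : Fin t → ℝ) : EReal :=
  ((2 / phiSecond φ₁ : ℝ) : EReal) * phiDiv φ₁ (realTable n) (meanVec X θ)

/-- The chi-squared distribution with `df` degrees of freedom: the law of the sum of the squares of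
`df` independent standard normal variables (the point mass at `0` if `df = 0`). -/
def chiSquared (df : ℕ) : Measure ℝ :=
  (Measure.pi fun _ : Fin df => gaussianReal 0 1).map fun z => ∑ i, z i ^ 2

end LMLC

end

/-! Write `w` for the standardized table, `wᵢ = (nᵢ - N m*ᵢ) / √(N m*ᵢ)`, and `A = diag(√m*) X`. For
`θ = θ₀ + η / √N` with `w` and `η` bounded, Taylor expansion of `φ` at `1` gives `(2 / φ''(1))
D_φ(n, m(θ)) = ‖w - A η‖² + o(1)` (`tendsto_realDiv_sub`). The right side does not depend on `φ`, so
the statistic for `φ₁` may be evaluated with the minimality known for `φ₂`.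

Dividing the constraints by `N` leaves one fixed smooth map of `ξ = θ - θ₀`, with derivative `Lᵀ
diag(m*) X` at `0`, surjective by the rank hypothesis. Let `V` be the image under `A` of its kernel.
Convexity of `φ₂` forces the minimizer to exist eventually and to lie within `O(1/√N)` of `θ₀`. Its
rescaled deviation is then asymptotically in the kernel, so the statistic is at least `dist(w, V)² +
o(1)`. The implicit function theorem supplies feasible points tangent to the projection of `w` on
`V`, and minimality gives the matching upper bound. This is `exists_testStat_tendsto`, a
deterministic statement along any filter on which `w` is bounded; there all counts are eventually
positive, so infinite values never intervene.

The sampling scheme confines `w` to a subspace `U` containing `V`, whence `dist(w, V)` is the length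
of the projection of `w` on `W = Vᗮ ⊓ U`. The explicit characteristic functions of Poisson and
conditioned Poisson tables converge to the standard Gaussian one in the directions of `U`, so this
squared length tends to chi-squared with `dim W = (k - c) - (t - c - r)` degrees of freedom
(`tendsto_map_norm_sq_proj`, `finrank_normalSpace`). Tightness of `‖w‖` and a sandwich of
distribution functions (`tendsto_real_of_approx`) join the two halves. -/

open Asymptotics

namespace LMLC

/-- The real-valued version of a divergence function. -/
noncomputable def realPhi (φ : ℝ → EReal) (x : ℝ) : ℝ := (φ x).toReal

/-! ### Convexity and local behaviour of `φ` at `1` -/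

namespace IsPhi

variable {φ : ℝ → EReal} (hφ : IsPhi φ)
include hφ

theorem coe_realPhi {x : ℝ} (hx : 0 < x) : ((realPhi φ x : ℝ) : EReal) = φ x :=
  EReal.coe_toReal (hφ.ne_top x hx) (hφ.ne_bot x hx.le)

theorem phiSecond_pos : 0 < phiSecond φ := hφ.deriv_two_one

theorem realPhi_one : realPhi φ 1 = 0 := by simp [realPhi, hφ.map_one]

theorem differentiableAt_realPhi {x : ℝ} (hx : 0 < x) : DifferentiableAt ℝ (realPhi φ) x :=
  hφ.differentiable x hx

theorem convexOn_realPhi : ConvexOn ℝ (Set.Ioi 0) (realPhi φ) := by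
  refine convexOn_iff_forall_pos.2 ⟨convex_Ioi 0, fun x hx y hy a b ha hb hab => ?_⟩
  have hx' : (0 : ℝ) < x := hx
  have hy' : (0 : ℝ) < y := hy
  have h := hφ.convex x y a b hx'.le hy'.le ha hb hab
  rw [← hφ.coe_realPhi hx', ← hφ.coe_realPhi hy',
    ← hφ.coe_realPhi (add_pos (mul_pos ha hx') (mul_pos hb hy'))] at h
  simp only [smul_eq_mul]
  exact_mod_cast h

theorem hasDerivAt_deriv_realPhi : HasDerivAt (deriv (realPhi φ)) (phiSecond φ) 1 :=
  (differentiableAt_of_deriv_ne_zero hφ.deriv_two_one.ne').hasDerivAt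

theorem deriv_realPhi_one : deriv (realPhi φ) 1 = 0 := hφ.deriv_one

/-- The second-order Taylor expansion with Peano remainder at `1`. -/
theorem isLittleO_realPhi_sub :
    (fun v => realPhi φ v - phiSecond φ / 2 * (v - 1) ^ 2) =o[𝓝 1] fun v => (v - 1) ^ 2 := by
  set a := phiSecond φ
  have h1 := hφ.hasDerivAt_deriv_realPhi.isLittleO
  rw [Asymptotics.isLittleO_iff] at h1 ⊢
  intro ε hε
  obtain ⟨δ, hδ, hball⟩ := Metric.eventually_nhds_iff.1 ((h1 hε).and (lt_mem_nhds one_pos))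
  refine Metric.eventually_nhds_iff.2 ⟨δ, hδ, fun v hv => ?_⟩
  set s := Metric.closedBall (1 : ℝ) |v - 1|
  have hs : ∀ y ∈ s, dist y 1 < δ := fun y hy => by
    have := Metric.mem_closedBall.1 hy
    rw [Real.dist_eq] at hv this ⊢
    linarith
  have hder : ∀ y ∈ s, HasDerivAt (fun v => realPhi φ v - a / 2 * (v - 1) ^ 2)
      (deriv (realPhi φ) y - a * (y - 1)) y := fun y hy => by
    refine (hφ.differentiableAt_realPhi (hball (hs y hy)).2).hasDerivAt.sub ?_
    exact ((((hasDerivAt_id' y).sub_const 1).fun_pow 2).const_mul (a / 2)).congr_deriv (by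
      norm_num; ring)
  -- `φ'` is differentiable only at `1`, so the mean value inequality is applied to `φ` minus its
  -- quadratic part, whose derivative is at most `ε |v - 1|` on the whole ball of that radius.
  have := Convex.norm_image_sub_le_of_norm_hasDerivWithin_le (f := fun v => realPhi φ v - a / 2 * (v - 1) ^ 2)
    (f' := fun y => deriv (realPhi φ) y - a * (y - 1)) (C := ε * |v - 1|) (s := s) (x := 1) (y := v)
    (fun y hy => (hder y hy).hasDerivWithinAt) (fun y hy => ?_) (convex_closedBall _ _)
    (Metric.mem_closedBall_self (abs_nonneg _)) (by simp [s, Real.dist_eq])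
  · simpa [hφ.realPhi_one, mul_assoc, pow_two, abs_mul] using this
  · have h := (hball (hs y hy)).1
    rw [hφ.deriv_realPhi_one, sub_zero, smul_eq_mul, mul_comm] at h
    refine h.trans (mul_le_mul_of_nonneg_left ?_ hε.le)
    simpa [s, Real.dist_eq] using hy

/-- Half of the quadratic term absorbs the Taylor remainder. -/
theorem eventually_le_realPhi : ∀ᶠ v in 𝓝 1, phiSecond φ / 4 * (v - 1) ^ 2 ≤ realPhi φ v := by
  have ha := hφ.phiSecond_pos
  filter_upwards [Asymptotics.isLittleO_iff.1 hφ.isLittleO_realPhi_sub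
    (show 0 < phiSecond φ / 4 by linarith)] with v hv
  rw [Real.norm_eq_abs, Real.norm_eq_abs, abs_of_nonneg (sq_nonneg (v - 1))] at hv
  linarith [(abs_le.1 hv).1]

/-- The quadratic lower bound makes `1` a local minimum, and convexity makes it global. -/
theorem realPhi_nonneg {v : ℝ} (hv : 0 < v) : 0 ≤ realPhi φ v := by
  have hmin : IsLocalMinOn (realPhi φ) (Set.Ioi 0) 1 := by
    refine IsLocalMin.on ?_ _
    filter_upwards [hφ.eventually_le_realPhi] with v hv
    rw [hφ.realPhi_one]
    exact (mul_nonneg (by linarith [hφ.phiSecond_pos]) (sq_nonneg _)).trans hv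
  have := IsMinOn.of_isLocalMinOn_of_convexOn (Set.mem_Ioi.2 (one_pos : (0 : ℝ) < 1)) hmin
    hφ.convexOn_realPhi
  simpa [hφ.realPhi_one] using this (show v ∈ Set.Ioi 0 from hv)

theorem realPhi_pos_near : ∀ᶠ δ in 𝓝[>] (0 : ℝ), 0 < realPhi φ (1 + δ) ∧ 0 < realPhi φ (1 - δ) := by
  have ha := hφ.phiSecond_pos
  have h1 : Tendsto (fun δ : ℝ => 1 + δ) (𝓝[>] 0) (𝓝 1) :=
    (Continuous.tendsto' (by fun_prop) 0 1 (by simp)).mono_left nhdsWithin_le_nhds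
  have h2 : Tendsto (fun δ : ℝ => 1 - δ) (𝓝[>] 0) (𝓝 1) :=
    (Continuous.tendsto' (by fun_prop) 0 1 (by simp)).mono_left nhdsWithin_le_nhds
  filter_upwards [h1.eventually hφ.eventually_le_realPhi, h2.eventually hφ.eventually_le_realPhi,
    self_mem_nhdsWithin] with δ h h' hδ
  have hδ' : (0 : ℝ) < δ := hδ
  constructor
  · exact lt_of_lt_of_le (by simp; positivity) h
  · exact lt_of_lt_of_le (by simp; positivity) h'

/-- If `φ(v) / v` is small, then `v` is close to `1`. -/
theorem exists_coercive {δ : ℝ} (hδ : 0 < δ) :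
    ∃ κ > 0, ∀ v, 0 < v → realPhi φ v ≤ κ * v → |v - 1| < δ := by
  obtain ⟨η, ⟨hp, hm⟩, hη0, hη⟩ := (hφ.realPhi_pos_near.and
    (Ioo_mem_nhdsGT (show (0 : ℝ) < min δ 1 by positivity))).exists
  have hηδ := hη.trans_le (min_le_left _ _)
  have hη1 := hη.trans_le (min_le_right _ _)
  -- Since `φ(1) = 0`, convexity gives `φ(v) / v ≥ φ(1 + η) / (1 + η)` for `v ≥ 1 + η` and `φ(v) ≥
  -- φ(1 - η)` for `v ≤ 1 - η`; the factor `1 / 2` makes both contradictions strict.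
  refine ⟨min (realPhi φ (1 + η) / (1 + η)) (realPhi φ (1 - η)) / 2, by positivity, fun v hv h => ?_⟩
  refine lt_of_lt_of_le ?_ hηδ.le
  by_contra! hcon
  rcases le_abs.1 hcon with h1 | h1
  · have hκ : realPhi φ v ≤ realPhi φ (1 + η) / (1 + η) / 2 * v :=
      h.trans (by gcongr; exact min_le_left _ _)
    have hv1 : 0 < v - 1 := by linarith
    have hc := hφ.convexOn_realPhi.2 (Set.mem_Ioi.2 (one_pos : (0 : ℝ) < 1))
      (Set.mem_Ioi.2 hv)
      (show 0 ≤ 1 - η / (v - 1) by rw [sub_nonneg, div_le_one hv1]; exact h1)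
      (show 0 ≤ η / (v - 1) by positivity) (by ring)
    have he : (1 - η / (v - 1)) • (1 : ℝ) + (η / (v - 1)) • v = 1 + η := by
      simp only [smul_eq_mul]; field_simp; ring
    rw [he, hφ.realPhi_one] at hc
    simp only [smul_eq_mul, mul_zero, zero_add] at hc
    rw [div_mul_eq_mul_div, le_div_iff₀ hv1] at hc
    have hb : η * realPhi φ v ≤ η * (realPhi φ (1 + η) / (1 + η) / 2 * v) := by gcongr
    set P := realPhi φ (1 + η) / (1 + η) with hP
    have hP0 : 0 < P := by positivity
    have hPe : realPhi φ (1 + η) = P * (1 + η) := by rw [hP]; field_simp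
    rw [hPe] at hc
    have h3 : (1 + η) * (v - 1) ≤ η * v / 2 := by
      have : P * ((1 + η) * (v - 1)) ≤ P * (η * v / 2) := by linarith
      exact le_of_mul_le_mul_left this hP0
    nlinarith
  · have hκ : realPhi φ v ≤ realPhi φ (1 - η) / 2 * v :=
      h.trans (by gcongr; exact min_le_right _ _)
    have hv1 : 0 < 1 - v := by linarith
    have hc := hφ.convexOn_realPhi.2 (Set.mem_Ioi.2 (one_pos : (0 : ℝ) < 1))
      (Set.mem_Ioi.2 hv)
      (show 0 ≤ 1 - η / (1 - v) by rw [sub_nonneg, div_le_one hv1]; linarith)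
      (show 0 ≤ η / (1 - v) by positivity) (by ring)
    have he : (1 - η / (1 - v)) • (1 : ℝ) + (η / (1 - v)) • v = 1 - η := by
      simp only [smul_eq_mul]; field_simp; ring
    rw [he, hφ.realPhi_one] at hc
    simp only [smul_eq_mul, mul_zero, zero_add] at hc
    have h2 : η / (1 - v) ≤ 1 := by rw [div_le_one hv1]; linarith
    have h3 := mul_le_mul_of_nonneg_right h2 (hφ.realPhi_nonneg hv)
    nlinarith

/-- The quadratic approximation of a summand of the divergence, when the ratio tends to `1`. -/
theorem tendsto_mul_realPhi_sub {ι : Type*} {l : Filter ι} {m v : ι → ℝ} (hv : Tendsto v l (𝓝 1))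
    (hb : (fun p => m p * (v p - 1) ^ 2) =O[l] fun _ => (1 : ℝ)) :
    Tendsto (fun p => 2 / phiSecond φ * (m p * realPhi φ (v p)) - m p * (v p - 1) ^ 2) l (𝓝 0) := by
  have ha := hφ.phiSecond_pos
  have h1 := (hφ.isLittleO_realPhi_sub.comp_tendsto hv)
  have h2 := ((Asymptotics.isBigO_refl m l).mul_isLittleO h1).const_mul_left (2 / phiSecond φ)
  have h3 := h2.trans_isBigO hb
  rw [Asymptotics.isLittleO_one_iff] at h3
  refine h3.congr fun p => ?_
  simp only [Function.comp]
  field_simp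

end IsPhi

/-! ### Asymptotics of a single cell -/

section Scalar

variable {ι : Type*} {l : Filter ι}

theorem tendsto_div_sqrt_zero {N y : ι → ℝ} (hN : Tendsto N l atTop)
    (hy : y =O[l] fun _ => (1 : ℝ)) : Tendsto (fun p => y p / √(N p)) l (𝓝 0) := by
  have h : (fun p => (√(N p))⁻¹) =o[l] fun _ => (1 : ℝ) :=
    (isLittleO_one_iff ℝ).2 (tendsto_inv_atTop_zero.comp (Real.tendsto_sqrt_atTop.comp hN))
  simpa [div_eq_mul_inv] using (isLittleO_one_iff ℝ).1 ((hy.mul_isLittleO h).congr_right (by simp))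

theorem add_sqrt_mul_eq {N μ : ℝ} (hN : 0 < N) (hμ : 0 < μ) (w : ℝ) :
    N * μ + √N * √μ * w = N * μ * (1 + w / √N / √μ) := by
  have h1 := Real.sqrt_pos.2 hN
  have h2 := Real.sqrt_pos.2 hμ
  have h3 : N * μ = √N * √N * (√μ * √μ) := by
    rw [Real.mul_self_sqrt hN.le, Real.mul_self_sqrt hμ.le]
  rw [h3]
  field_simp

/-- The hypothesis forces `u → 1`, where `log u = O(u - 1)`; rates for ratios thus pass to linear
predictors. -/
theorem isBigO_sqrt_mul_log {N u : ι → ℝ} (hN : Tendsto N l atTop)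
    (hu : (fun p => √(N p) * (u p - 1)) =O[l] fun _ => (1 : ℝ)) :
    (fun p => √(N p) * Real.log (u p)) =O[l] fun _ => (1 : ℝ) := by
  have h1 : Tendsto u l (𝓝 1) := by
    have h := tendsto_div_sqrt_zero hN hu
    have h2 : Tendsto (fun p => u p - 1) l (𝓝 0) := by
      refine h.congr' ?_
      filter_upwards [hN.eventually_gt_atTop 0] with p hp
      have := Real.sqrt_pos.2 hp
      field_simp
    simpa using h2.add_const 1
  have h2 : (fun v => Real.log v) =O[𝓝 1] fun v => v - 1 := by
    simpa using (Real.hasDerivAt_log one_ne_zero).isBigO_sub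
  exact ((isBigO_refl (fun p => √(N p)) l).mul (h2.comp_tendsto h1)).trans hu

/-- The local quadratic approximation of one cell of the divergence, for a mean and a count within
a standard deviation of `N μ`. -/
theorem tendsto_cell_sub {φ : ℝ → EReal} (hφ : IsPhi φ) {μ : ℝ} (hμ : 0 < μ) {N w y : ι → ℝ}
    (hN : Tendsto N l atTop) (hw : w =O[l] fun _ => (1 : ℝ)) (hy : y =O[l] fun _ => (1 : ℝ)) :
    Tendsto (fun p => 2 / phiSecond φ * (N p * μ * Real.exp (y p / √(N p)) *
        realPhi φ ((N p * μ + √(N p) * √μ * w p) / (N p * μ * Real.exp (y p / √(N p)))))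
      - (w p - √μ * y p) ^ 2) l (𝓝 0) := by
  have hsμ : 0 < √μ := Real.sqrt_pos.2 hμ
  have hsq : √μ ^ 2 = μ := Real.sq_sqrt hμ.le
  have hN0 := hN.eventually_gt_atTop 0
  have hx0 := tendsto_div_sqrt_zero hN hy
  have hw0 := tendsto_div_sqrt_zero hN hw
  have he : Tendsto (fun p => Real.exp (y p / √(N p))) l (𝓝 1) := by
    simpa [Function.comp_def] using (Real.continuous_exp.tendsto 0).comp hx0
  have he' : Tendsto (fun p => Real.exp (-(y p / √(N p)))) l (𝓝 1) := by
    simpa [Function.comp_def] using (Real.continuous_exp.tendsto 0).comp (by simpa using hx0.neg)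
  -- `v` is the ratio of count to mean, and `√N (v - 1) = b + o(1)`, with `μ b² = (w - √μ y)²` the
  -- desired limit form.
  set v : ι → ℝ := fun p => (1 + w p / √(N p) / √μ) * Real.exp (-(y p / √(N p))) with hv
  set b : ι → ℝ := fun p => w p / √μ - y p with hb
  have hb1 : b =O[l] fun _ => (1 : ℝ) := by
    refine IsBigO.sub ?_ hy
    simpa [div_eq_inv_mul] using hw.const_mul_left (√μ)⁻¹
  have hv1 : Tendsto v l (𝓝 1) := by
    simpa using ((hw0.div_const (√μ)).const_add 1).mul he'
  have hexp : Tendsto (fun p => √(N p) * (Real.exp (-(y p / √(N p))) - 1) + y p) l (𝓝 0) := by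
    have h1 : (fun x => Real.exp x - 1 - x) =o[𝓝 0] fun x => x := by
      simpa using (Real.hasDerivAt_exp 0).isLittleO
    have h2 := h1.comp_tendsto (show Tendsto (fun p => -(y p / √(N p))) l (𝓝 0) by
      simpa using hx0.neg)
    have h3 := (isBigO_refl (fun p => √(N p)) l).mul_isLittleO h2
    have h4 : (fun p => √(N p) * (-(y p / √(N p)))) =O[l] fun _ => (1 : ℝ) := by
      refine hy.neg_left.congr' ?_ EventuallyEq.rfl
      filter_upwards [hN0] with p hp
      have := Real.sqrt_pos.2 hp
      field_simp
    refine ((isLittleO_one_iff ℝ).1 (h3.trans_isBigO h4)).congr' ?_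
    filter_upwards [hN0] with p hp
    have := Real.sqrt_pos.2 hp
    simp only [Function.comp]
    field_simp
    ring
  have hρ : Tendsto (fun p => √(N p) * (v p - 1) - b p) l (𝓝 0) := by
    have h1 : Tendsto (fun p => w p / √μ * (Real.exp (-(y p / √(N p))) - 1)) l (𝓝 0) := by
      have h2 : (fun p => Real.exp (-(y p / √(N p))) - 1) =o[l] fun _ => (1 : ℝ) :=
        (isLittleO_one_iff ℝ).2 (by simpa using he'.sub_const 1)
      have h3 : (fun p => w p / √μ) =O[l] fun _ => (1 : ℝ) := by
        simpa [div_eq_inv_mul] using hw.const_mul_left (√μ)⁻¹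
      exact (isLittleO_one_iff ℝ).1 ((h3.mul_isLittleO h2).congr_right (by simp))
    have h4 := h1.add hexp
    simp only [add_zero] at h4
    refine h4.congr' ?_
    filter_upwards [hN0] with p hp
    have := Real.sqrt_pos.2 hp
    simp only [hv, hb]
    field_simp
    ring
  have hsv : (fun p => √(N p) * (v p - 1)) =O[l] fun _ => (1 : ℝ) := by
    have := (((isLittleO_one_iff ℝ).2 hρ).isBigO).add hb1
    simpa using this
  have hmv : ∀ᶠ p in l, N p * μ * Real.exp (y p / √(N p)) * (v p - 1) ^ 2 =
      μ * Real.exp (y p / √(N p)) * (√(N p) * (v p - 1)) ^ 2 := by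
    filter_upwards [hN0] with p hp
    rw [mul_pow, Real.sq_sqrt hp.le]; ring
  have hmain := hφ.tendsto_mul_realPhi_sub (m := fun p => N p * μ * Real.exp (y p / √(N p))) hv1 (by
    refine IsBigO.congr' ?_ (EventuallyEq.symm hmv) EventuallyEq.rfl
    have h1 : (fun p => μ * Real.exp (y p / √(N p))) =O[l] fun _ => (1 : ℝ) :=
      (he.const_mul μ).isBigO_one ℝ
    simpa using h1.mul (hsv.pow 2))
  have hdiff : Tendsto (fun p => N p * μ * Real.exp (y p / √(N p)) * (v p - 1) ^ 2 - μ * b p ^ 2) l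
      (𝓝 0) := by
    have h1 : (fun p => μ * (Real.exp (y p / √(N p)) - 1)) =o[l] fun _ => (1 : ℝ) :=
      (isLittleO_one_iff ℝ).2 (by simpa using (he.sub_const 1).const_mul μ)
    have h2 := h1.mul_isBigO (hsv.pow 2)
    have h3 := ((isLittleO_one_iff ℝ).2 hρ).mul_isBigO (hsv.add hb1) |>.const_mul_left μ
    have h4 := (h2.congr_right (g₂ := fun _ => (1 : ℝ)) (by simp)).add
      (h3.congr_right (g₂ := fun _ => (1 : ℝ)) (by simp))
    refine ((isLittleO_one_iff ℝ).1 h4).congr' ?_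
    filter_upwards [hmv] with p hp
    rw [hp]
    ring
  have hsum := hmain.add hdiff
  simp only [add_zero] at hsum
  refine hsum.congr' ?_
  filter_upwards [hN0] with p hp
  have hvp : v p = (N p * μ + √(N p) * √μ * w p) / (N p * μ * Real.exp (y p / √(N p))) := by
    rw [add_sqrt_mul_eq hp hμ]
    simp only [hv, Real.exp_neg]
    rw [mul_div_mul_left _ _ (by positivity)]
    rfl
  have hbp : μ * b p ^ 2 = (w p - √μ * y p) ^ 2 := by
    simp only [hb]
    nth_rw 1 [← hsq]
    field_simp
  rw [← hvp, hbp]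
  ring

/-- A bounded summand of the divergence forces the mean to be within `O(√N)` of the count. -/
theorem isBigO_log_ratio {φ : ℝ → EReal} (hφ : IsPhi φ) {μ : ℝ} (hμ : 0 < μ) {N w x B : ι → ℝ}
    (hN : Tendsto N l atTop) (hw : w =O[l] fun _ => (1 : ℝ)) (hB : B =O[l] fun _ => (1 : ℝ))
    (hle : ∀ᶠ p in l, N p * μ * Real.exp (x p) *
      realPhi φ ((N p * μ + √(N p) * √μ * w p) / (N p * μ * Real.exp (x p))) ≤ B p) :
    (fun p => √(N p) * x p) =O[l] fun _ => (1 : ℝ) := by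
  have ha := hφ.phiSecond_pos
  have hN0 := hN.eventually_gt_atTop 0
  have hw0 := tendsto_div_sqrt_zero hN hw
  set u : ι → ℝ := fun p => 1 + w p / √(N p) / √μ with hu
  have hu1 : Tendsto u l (𝓝 1) := by simpa using (hw0.div_const (√μ)).const_add 1
  have hup : ∀ᶠ p in l, 1 / 2 < u p := hu1.eventually (lt_mem_nhds (by norm_num))
  have hn : ∀ᶠ p in l, N p * μ + √(N p) * √μ * w p = N p * μ * u p := by
    filter_upwards [hN0] with p hp
    exact add_sqrt_mul_eq hp hμ _
  set v : ι → ℝ := fun p => u p / Real.exp (x p) with hv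
  -- The bound on the summand reads `φ(v) ≤ κ v` with `κ = B / (N μ u) → 0`, so coercivity gives `v
  -- → 1` without any rate.
  have hkey : ∀ᶠ p in l, 0 < v p ∧ realPhi φ (v p) ≤ B p / (N p * μ * u p) * v p := by
    filter_upwards [hN0, hup, hn, hle] with p hp hup hn hle
    have h2 : 0 < u p := by linarith
    refine ⟨by positivity, ?_⟩
    rw [hn, mul_div_mul_left _ _ (by positivity)] at hle
    have : B p / (N p * μ * u p) * v p = B p / (N p * μ * Real.exp (x p)) := by
      simp only [hv]; field_simp
    rw [this, le_div_iff₀ (by positivity), mul_comm]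
    exact hle
  have hBN : Tendsto (fun p => B p / (N p * μ * u p)) l (𝓝 0) := by
    have h1 : Tendsto (fun p => (N p * (μ * u p))⁻¹) l (𝓝 0) :=
      tendsto_inv_atTop_zero.comp
        (hN.atTop_mul_pos (show 0 < μ * 1 by simpa using hμ) (hu1.const_mul μ))
    have h2 := hB.mul_isLittleO ((isLittleO_one_iff ℝ).2 h1)
    simpa [div_eq_mul_inv, mul_assoc] using
      (isLittleO_one_iff ℝ).1 (h2.congr_right (g₂ := fun _ => (1 : ℝ)) (by simp))
  have hv1 : Tendsto v l (𝓝 1) := by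
    rw [Metric.tendsto_nhds]
    intro δ hδ
    obtain ⟨κ, hκ, h⟩ := hφ.exists_coercive hδ
    filter_upwards [hkey, hBN.eventually (gt_mem_nhds hκ)] with p ⟨hvp, hp⟩ hlt
    rw [Real.dist_eq]
    exact h _ hvp (hp.trans (by gcongr))
  have hsv : (fun p => √(N p) * (v p - 1)) =O[l] fun _ => (1 : ℝ) := by
    have hsqO : (fun p => (√(N p) * (v p - 1)) ^ 2) =O[l] fun _ => (1 : ℝ) := by
      -- Once `v` is near `1`, the quadratic lower bound yields the rate. With `u > 1/2` and `v < 2`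
      -- it gives `(φ''(1) / 4) (v - 1)² N μ / 2 ≤ 2 B`, hence the factor `16`.
      refine IsBigO.trans ?_ (hB.const_mul_left (16 / (phiSecond φ * μ)))
      refine IsBigO.of_bound 1 ?_
      filter_upwards [hkey, hN0, hup, hv1.eventually hφ.eventually_le_realPhi,
        hv1.eventually (gt_mem_nhds (show (1 : ℝ) < 2 by norm_num))] with p ⟨hvp, hp⟩ hNp hup hq hv2
      have h2 : 0 < u p := by linarith
      have h3 := hq.trans hp
      have hB0 : 0 ≤ B p := by
        have h5 : 0 ≤ B p / (N p * μ * u p) * v p := (hφ.realPhi_nonneg hvp).trans hp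
        have h6 := nonneg_of_mul_nonneg_left h5 hvp
        rwa [le_div_iff₀ (by positivity), zero_mul] at h6
      rw [one_mul, Real.norm_of_nonneg (by positivity), Real.norm_of_nonneg (by positivity), mul_pow,
        Real.sq_sqrt hNp.le, div_mul_eq_mul_div, le_div_iff₀ (by positivity)]
      rw [div_mul_eq_mul_div (B p), le_div_iff₀ (by positivity)] at h3
      have h7 : B p * v p ≤ B p * 2 := by gcongr
      have h8 : phiSecond φ / 4 * (v p - 1) ^ 2 * (N p * μ * (1 / 2)) ≤
          phiSecond φ / 4 * (v p - 1) ^ 2 * (N p * μ * u p) := by gcongr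
      nlinarith
    exact IsBigO.of_pow two_ne_zero (hsqO.congr_right fun _ => (one_pow 2).symm)
  have hsu : (fun p => √(N p) * (u p - 1)) =O[l] fun _ => (1 : ℝ) := by
    refine (hw.const_mul_left (√μ)⁻¹).congr' ?_ EventuallyEq.rfl
    filter_upwards [hN0] with p hp
    have hsp := Real.sqrt_pos.2 hp
    simp only [hu]
    field_simp
    ring
  -- Here `x = log u - log v`.
  refine ((isBigO_sqrt_mul_log hN hsu).sub (isBigO_sqrt_mul_log hN hsv)).congr' ?_ EventuallyEq.rfl
  filter_upwards [hup] with p hp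
  have h2 : 0 < u p := by linarith
  simp only [hv]
  rw [Real.log_div h2.ne' (Real.exp_pos _).ne', Real.log_exp]
  ring

end Scalar

/-! ### Linearization of the constraints -/

section LinearAlgebra

variable {ι : Type*} {l : Filter ι}

theorem isBigO_pi_one {κ : Type*} [Fintype κ] {f : ι → κ → ℝ} :
    f =O[l] (fun _ => (1 : ℝ)) ↔ ∀ i, (fun p => f p i) =O[l] fun _ => (1 : ℝ) := isBigO_pi

theorem isBigO_clm_comp {E F : Type*} [NormedAddCommGroup E] [NormedSpace ℝ E] [FiniteDimensional ℝ E]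
    [NormedAddCommGroup F] [NormedSpace ℝ F] (f : E →ₗ[ℝ] F) (u : ι → E) :
    (fun p => f (u p)) =O[l] u :=
  (LinearMap.toContinuousLinearMap f).isBigO_comp u l

/-- Near-solutions of a surjective linear system are close to solutions. -/
theorem exists_ker_tendsto_sub {E F : Type*} [NormedAddCommGroup E] [NormedSpace ℝ E]
    [NormedAddCommGroup F] [NormedSpace ℝ F] [FiniteDimensional ℝ F]
    {f : E →ₗ[ℝ] F} (hf : LinearMap.range f = ⊤) {u : ι → E} (hu : Tendsto (fun p => f (u p)) l (𝓝 0)) :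
    ∃ u' : ι → E, (∀ p, f (u' p) = 0) ∧ Tendsto (fun p => u p - u' p) l (𝓝 0) := by
  obtain ⟨g, hg⟩ := f.exists_rightInverse_of_surjective hf
  refine ⟨fun p => u p - g (f (u p)), fun p => ?_, ?_⟩
  · have := LinearMap.congr_fun hg (f (u p))
    simp only [LinearMap.comp_apply, LinearMap.id_apply] at this
    simp [this]
  · simpa [Function.comp_def] using
      ((LinearMap.toContinuousLinearMap g).continuous.tendsto 0).comp hu

/-- Bounded solutions of the linearized constraints are tangent to solutions of the constraints. -/
theorem exists_tangent_solution {E F : Type*} [NormedAddCommGroup E] [NormedSpace ℝ E]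
    [FiniteDimensional ℝ E] [NormedAddCommGroup F] [NormedSpace ℝ F] [FiniteDimensional ℝ F]
    {G : E → F} {G' : E →L[ℝ] F} (hG : HasStrictFDerivAt G G' 0) (hG' : G'.range = ⊤)
    {s : ι → ℝ} (hs : Tendsto s l atTop) {u : ι → E} (hu : u =O[l] fun _ => (1 : ℝ))
    (hu0 : ∀ p, G' (u p) = 0) :
    ∃ ξ : ι → E, (∀ᶠ p in l, G (ξ p) = G 0) ∧ Tendsto (fun p => s p • ξ p - u p) l (𝓝 0) := by
  have : CompleteSpace E := FiniteDimensional.complete ℝ E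
  -- The implicit function parametrizes the level set by the kernel, with derivative at `0` the
  -- inclusion; evaluating it at `u / s` gives `ξ = u / s + o(1 / s)`.
  set g := hG.implicitFunction G G' hG' (G 0) with hg
  set y : ι → G'.ker := fun p => (s p)⁻¹ • ⟨u p, hu0 p⟩ with hy
  have hs0 := hs.eventually_gt_atTop 0
  have hyO : (fun p => (y p : E)) =O[l] fun p => (s p)⁻¹ := by
    simpa [hy] using (isBigO_refl (fun p => (s p)⁻¹) l).smul hu
  have hy0 : Tendsto y l (𝓝 0) := by
    have h := hyO.trans_tendsto (tendsto_inv_atTop_zero.comp hs)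
    rw [tendsto_subtype_rng]
    simpa using h
  refine ⟨fun p => g (y p), ?_, ?_⟩
  · have h1 := hG.map_implicitFunction_eq hG'
    have h2 : Tendsto (fun p => (G 0, y p)) l (𝓝 (G 0, 0)) := tendsto_const_nhds.prodMk_nhds hy0
    exact h2.eventually h1
  · have h1 := (hG.to_implicitFunction hG').hasFDerivAt.isLittleO.comp_tendsto hy0
    have h2 : (fun p => g (y p) - y p) =o[l] fun p => (s p)⁻¹ := by
      refine IsLittleO.trans_isBigO ?_ hyO
      refine (h1.congr_left (f₂ := fun p => g (y p) - y p) fun p => ?_).trans_isBigO ?_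
      · simp [hg]
      · exact IsBigO.of_norm_right (IsBigO.of_bound 1 (Eventually.of_forall fun p => by simp))
    have h3 := (isBigO_refl s l).smul_isLittleO h2
    refine (isLittleO_one_iff ℝ).1 ((h3.congr' ?_ ?_))
    · filter_upwards [hs0] with p hp
      simp [hy, smul_sub, smul_smul, hp.ne']
    · filter_upwards [hs0] with p hp
      simp [hp.ne']

/-- Multiply `0 = G(ξ) - G(0) = G' ξ + o(ξ)` by `s`, where `ξ = O(1 / s)`. This is the converse
direction to `exists_tangent_solution`. -/
theorem tendsto_deriv_of_eq {E F : Type*} [NormedAddCommGroup E] [NormedSpace ℝ E]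
    [NormedAddCommGroup F] [NormedSpace ℝ F]
    {G : E → F} {G' : E →L[ℝ] F} (hG : HasFDerivAt G G' 0)
    {s : ι → ℝ} (hs : Tendsto s l atTop) {ξ : ι → E} (hξ : (fun p => s p • ξ p) =O[l] fun _ => (1 : ℝ))
    (hξ0 : ∀ᶠ p in l, G (ξ p) = G 0) : Tendsto (fun p => G' (s p • ξ p)) l (𝓝 0) := by
  have hs0 := hs.eventually_gt_atTop 0
  have hξO : ξ =O[l] fun p => (s p)⁻¹ := by
    refine ((isBigO_refl (fun p => (s p)⁻¹) l).smul hξ).congr' ?_ (by simp)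
    filter_upwards [hs0] with p hp
    simp [smul_smul, hp.ne']
  have h0 : Tendsto ξ l (𝓝 0) := hξO.trans_tendsto (tendsto_inv_atTop_zero.comp hs)
  have h1 := (hG.isLittleO.comp_tendsto h0).trans_isBigO (by simpa [Function.comp_def] using hξO)
  have h2 := ((isBigO_refl s l).smul_isLittleO h1).neg_left
  refine (isLittleO_one_iff ℝ).1 (h2.congr' ?_ ?_)
  · filter_upwards [hξ0] with p hp
    simp [hp]
  · filter_upwards [hs0] with p hp
    simp [hp.ne']

end LinearAlgebra

/-! ### The loglinear model and existence of minimizers -/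

section Model

variable {k t : ℕ}

/-- The design matrix in the coordinates that standardize Poisson counts with mean `mstar`. -/
noncomputable def scaledDesign (X : Matrix (Fin k) (Fin t) ℝ) (mstar : Fin k → ℝ) :
    (Fin t → ℝ) →ₗ[ℝ] EuclideanSpace ℝ (Fin k) :=
  (WithLp.linearEquiv 2 ℝ (Fin k → ℝ)).symm.toLinearMap ∘ₗ
    (diagonal (fun i => √(mstar i)) * X).mulVecLin

theorem scaledDesign_apply (X : Matrix (Fin k) (Fin t) ℝ) (mstar : Fin k → ℝ) (η : Fin t → ℝ)
    (i : Fin k) : scaledDesign X mstar η i = √(mstar i) * (X *ᵥ η) i := by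
  simp [scaledDesign]
  rw [← mulVec_mulVec, mulVec_diagonal]

/-- The derivative at `0` of the normalized constraints `ξ ↦ Lᵀ (mstar ∘ exp (X ξ))`. -/
noncomputable def constraintDeriv {κ : Type*} [Fintype κ] (X : Matrix (Fin k) (Fin t) ℝ)
    (L : Matrix (Fin k) κ ℝ) (mstar : Fin k → ℝ) : (Fin t → ℝ) →ₗ[ℝ] (κ → ℝ) :=
  (Lᵀ * diagonal mstar * X).mulVecLin

/-- The tangent space of the constrained model, in standardized coordinates. -/
noncomputable def tangentSpace {κ : Type*} [Fintype κ] (X : Matrix (Fin k) (Fin t) ℝ)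
    (L : Matrix (Fin k) κ ℝ) (mstar : Fin k → ℝ) : Submodule ℝ (EuclideanSpace ℝ (Fin k)) :=
  (LinearMap.ker (constraintDeriv X L mstar)).map (scaledDesign X mstar)

/-- Strict differentiability is what the implicit function theorem needs. -/
theorem hasStrictFDerivAt_constraint {κ : Type*} [Fintype κ] (X : Matrix (Fin k) (Fin t) ℝ)
    (L : Matrix (Fin k) κ ℝ) (mstar : Fin k → ℝ) :
    HasStrictFDerivAt (fun ξ => Lᵀ *ᵥ fun i => mstar i * Real.exp ((X *ᵥ ξ) i))
      (LinearMap.toContinuousLinearMap (constraintDeriv X L mstar)) 0 := by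
  have h1 : HasStrictFDerivAt (fun ξ => fun i => mstar i * Real.exp ((X *ᵥ ξ) i))
      (LinearMap.toContinuousLinearMap (diagonal mstar * X).mulVecLin) 0 := by
    rw [hasStrictFDerivAt_pi']
    intro i
    have h2 : HasStrictFDerivAt (fun ξ : Fin t → ℝ => (X *ᵥ ξ) i)
        ((ContinuousLinearMap.proj i).comp (LinearMap.toContinuousLinearMap X.mulVecLin)) 0 :=
      ContinuousLinearMap.hasStrictFDerivAt
        ((ContinuousLinearMap.proj (R := ℝ) (φ := fun _ : Fin k => ℝ) i).comp
          (LinearMap.toContinuousLinearMap X.mulVecLin))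
    refine (h2.exp.const_mul (mstar i)).congr_fderiv ?_
    ext ξ
    simp
    rw [← mulVec_mulVec, mulVec_diagonal]
  have h3 := (LinearMap.toContinuousLinearMap Lᵀ.mulVecLin).hasStrictFDerivAt
    (x := fun i => mstar i * Real.exp ((X *ᵥ 0) i))
  refine (HasStrictFDerivAt.comp (0 : Fin t → ℝ) h3 h1).congr_fderiv ?_
  ext ξ
  simp [constraintDeriv]

theorem scaledDesign_injective {X : Matrix (Fin k) (Fin t) ℝ}
    (hX : Function.Injective X.mulVec) {mstar : Fin k → ℝ} (hm : ∀ i, 0 < mstar i) :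
    Function.Injective (scaledDesign X mstar) := by
  intro a b hab
  refine hX (funext fun i => ?_)
  have := congrArg (fun v : EuclideanSpace ℝ (Fin k) => v i) hab
  simp only [scaledDesign_apply] at this
  exact mul_left_cancel₀ (Real.sqrt_pos.2 (hm i)).ne' this

/-- The real-valued `φ`-divergence between positive vectors. -/
noncomputable def realDiv (φ : ℝ → EReal) (a b : Fin k → ℝ) : ℝ :=
  ∑ i, b i * realPhi φ (a i / b i)

theorem phiDiv_eq_realDiv {φ : ℝ → EReal} (hφ : IsPhi φ) {a b : Fin k → ℝ} (ha : ∀ i, 0 < a i)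
    (hb : ∀ i, 0 < b i) : phiDiv φ a b = (realDiv φ a b : ℝ) := by
  have : ((realDiv φ a b : ℝ) : EReal) = ∑ i, ((b i * realPhi φ (a i / b i) : ℝ) : EReal) :=
    map_sum (⟨⟨Real.toEReal, EReal.coe_zero⟩, EReal.coe_add⟩ : ℝ →+ EReal) _ _
  rw [this]
  refine Finset.sum_congr rfl fun i _ => ?_
  rw [phiTerm, if_neg (hb i).ne', EReal.coe_mul, hφ.coe_realPhi (div_pos (ha i) (hb i))]

theorem meanVec_pos (X : Matrix (Fin k) (Fin t) ℝ) (θ : Fin t → ℝ) (i : Fin k) :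
    0 < meanVec X θ i := Real.exp_pos _

theorem continuous_meanVec (X : Matrix (Fin k) (Fin t) ℝ) : Continuous (meanVec X) := by
  unfold meanVec
  fun_prop

theorem mul_realPhi_le_realDiv {φ : ℝ → EReal} (hφ : IsPhi φ) {a b : Fin k → ℝ} (ha : ∀ i, 0 < a i)
    (hb : ∀ i, 0 < b i) (i : Fin k) : b i * realPhi φ (a i / b i) ≤ realDiv φ a b :=
  Finset.single_le_sum (f := fun i => b i * realPhi φ (a i / b i))
    (fun j _ => mul_nonneg (hb j).le (hφ.realPhi_nonneg (div_pos (ha j) (hb j)))) (Finset.mem_univ i)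

/-- A minimizer exists if some parameter has a small divergence relative to the counts. -/
theorem exists_isMinOn_realDiv {φ : ℝ → EReal} (hφ : IsPhi φ) {X : Matrix (Fin k) (Fin t) ℝ}
    (hX : Function.Injective X.mulVec) {a : Fin k → ℝ} (ha : ∀ i, 0 < a i) {Θ : Set (Fin t → ℝ)}
    (hΘ : IsClosed Θ) {κ : ℝ} (hκ : ∀ v, 0 < v → realPhi φ v ≤ κ * v → |v - 1| < 1 / 2)
    {θ₀ : Fin t → ℝ} (hθ₀ : θ₀ ∈ Θ) (hle : ∀ i, realDiv φ a (meanVec X θ₀) ≤ κ * a i) :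
    ∃ θ ∈ Θ, IsMinOn (fun θ => realDiv φ a (meanVec X θ)) Θ θ := by
  have hcont : Continuous fun θ => realDiv φ a (meanVec X θ) := by
    unfold realDiv
    refine continuous_finsetSum _ fun i _ => ?_
    have h1 : Continuous fun θ => meanVec X θ i := (continuous_apply i).comp (continuous_meanVec X)
    refine h1.mul ?_
    rw [continuous_iff_continuousAt]
    intro θ
    exact ContinuousAt.comp (f := fun θ => a i / meanVec X θ i) (g := realPhi φ)
      (hφ.differentiableAt_realPhi (div_pos (ha i) (meanVec_pos X θ i))).continuousAt
      ((continuous_const.div h1 fun θ => (meanVec_pos X θ i).ne').continuousAt)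
  set S := Θ ∩ {θ | realDiv φ a (meanVec X θ) ≤ realDiv φ a (meanVec X θ₀)} with hS
  have hSclosed : IsClosed S := hΘ.inter (isClosed_le hcont continuous_const)
  have hemb : IsClosedEmbedding X.mulVecLin :=
    LinearMap.isClosedEmbedding_of_injective (LinearMap.ker_eq_bot.2 hX)
  -- On the sublevel set every ratio of count to mean lies between `1/2` and `3/2`, so each linear
  -- predictor is within `log 2` of the log count; as `X` is a closed embedding, this confines `θ`
  -- to a compact set.
  have hsub : S ⊆ X.mulVecLin ⁻¹'
      Set.pi Set.univ fun i => Set.Icc (Real.log (a i) - Real.log 2) (Real.log (a i) + Real.log 2) := by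
    rintro θ ⟨-, hθ⟩ i -
    have hm := meanVec_pos X θ i
    have hv : 0 < a i / meanVec X θ i := div_pos (ha i) hm
    have h1 := (mul_realPhi_le_realDiv hφ ha (meanVec_pos X θ) i).trans
      ((Set.mem_ofPred_eq ▸ hθ).trans (hle i))
    have h2 := hκ _ hv (by
      rw [← mul_div_assoc, le_div_iff₀ hm, mul_comm]
      exact h1)
    have hX' : (X.mulVecLin θ) i = Real.log (a i) - Real.log (a i / meanVec X θ i) := by
      rw [Real.log_div (ha i).ne' hm.ne']
      simp [meanVec]
    obtain ⟨h3, h4⟩ := abs_lt.1 h2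
    have h5 : Real.log (a i / meanVec X θ i) ≤ Real.log 2 := Real.log_le_log hv (by linarith)
    have h6 : -Real.log 2 ≤ Real.log (a i / meanVec X θ i) := by
      rw [← Real.log_inv]
      exact Real.log_le_log (by norm_num) (by linarith)
    rw [hX']
    constructor <;> linarith
  have hcomp : IsCompact S :=
    (hemb.isCompact_preimage (isCompact_univ_pi fun i => isCompact_Icc)).of_isClosed_subset hSclosed hsub
  obtain ⟨θ, hθ, hmin⟩ := hcomp.exists_isMinOn ⟨θ₀, hθ₀, Set.mem_ofPred_eq ▸ le_rfl⟩ hcont.continuousOn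
  refine ⟨θ, hθ.1, fun θ' hθ' => ?_⟩
  by_cases h : realDiv φ a (meanVec X θ') ≤ realDiv φ a (meanVec X θ₀)
  · exact hmin ⟨hθ', h⟩
  · exact (hmin ⟨hθ₀, Set.mem_ofPred_eq ▸ le_rfl⟩).trans (not_le.1 h).le

end Model

/-! ### Deterministic limit of the statistic -/

section Asymptotic

variable {ι : Type*} {l : Filter ι}

theorem tendsto_norm_sq_sub {E : Type*} [NormedAddCommGroup E]
    {u u' : ι → E} (hu : u =O[l] fun _ => (1 : ℝ)) (h : Tendsto (fun p => u p - u' p) l (𝓝 0)) :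
    Tendsto (fun p => ‖u p‖ ^ 2 - ‖u' p‖ ^ 2) l (𝓝 0) := by
  have h0 : (fun p => u p - u' p) =o[l] fun _ => (1 : ℝ) := (isLittleO_one_iff ℝ).2 h
  have hu' : u' =O[l] fun _ => (1 : ℝ) := by simpa using hu.sub h0.isBigO
  have h1 : (fun p => ‖u p‖ - ‖u' p‖) =o[l] fun _ => (1 : ℝ) :=
    IsBigO.trans_isLittleO (IsBigO.of_bound 1 (Eventually.of_forall fun p => by
      simpa using abs_norm_sub_norm_le (u p) (u' p))) h0
  have h2 := h1.mul_isBigO (hu.norm_left.add hu'.norm_left)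
  refine (isLittleO_one_iff ℝ).1 ((h2.congr_right (g₂ := fun _ => (1 : ℝ)) (by simp)).congr_left
    fun p => ?_)
  ring

variable {k t : ℕ} {X : Matrix (Fin k) (Fin t) ℝ} {mstar : Fin k → ℝ} {N : ι → ℝ}
  {θ₀ : ι → Fin t → ℝ} {a : ι → Fin k → ℝ} {w : ι → EuclideanSpace ℝ (Fin k)}

theorem meanVec_add {θ₀ ξ : Fin t → ℝ} {N : ℝ} (h : meanVec X θ₀ = N • mstar) (i : Fin k) :
    meanVec X (θ₀ + ξ) i = N * mstar i * Real.exp ((X *ᵥ ξ) i) := by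
  have h1 := congrFun h i
  simp only [meanVec, Pi.smul_apply, smul_eq_mul] at h1 ⊢
  rw [mulVec_add, Pi.add_apply, Real.exp_add, h1]

theorem isBigO_coord (hw : w =O[l] fun _ => (1 : ℝ)) (i : Fin k) :
    (fun p => w p i) =O[l] fun _ => (1 : ℝ) :=
  ((EuclideanSpace.proj (𝕜 := ℝ) i).isBigO_comp w l).trans hw

/-- The local quadratic approximation of the divergence. -/
theorem tendsto_realDiv_sub {φ : ℝ → EReal} (hφ : IsPhi φ) (hm : ∀ i, 0 < mstar i)
    (hN : Tendsto N l atTop) (hθ₀ : ∀ p, meanVec X (θ₀ p) = N p • mstar)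
    (hw : w =O[l] fun _ => (1 : ℝ))
    (ha : ∀ p i, a p i = N p * mstar i + √(N p) * √(mstar i) * w p i)
    {ξ : ι → Fin t → ℝ} (hξ : (fun p => √(N p) • ξ p) =O[l] fun _ => (1 : ℝ)) :
    Tendsto (fun p => 2 / phiSecond φ * realDiv φ (a p) (meanVec X (θ₀ p + ξ p)) -
      ‖w p - scaledDesign X mstar (√(N p) • ξ p)‖ ^ 2) l (𝓝 0) := by
  have hy : ∀ i, (fun p => (X *ᵥ (√(N p) • ξ p)) i) =O[l] fun _ => (1 : ℝ) :=
    isBigO_pi_one.1 ((isBigO_clm_comp X.mulVecLin _).trans hξ)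
  have h1 := tendsto_finsetSum Finset.univ fun i _ =>
    tendsto_cell_sub hφ (hm i) hN (isBigO_coord hw i) (hy i)
  simp only [Finset.sum_const_zero] at h1
  refine h1.congr' ?_
  filter_upwards [hN.eventually_gt_atTop 0] with p hp
  have hsp := Real.sqrt_pos.2 hp
  rw [Finset.sum_sub_distrib, EuclideanSpace.norm_sq_eq, realDiv, Finset.mul_sum]
  congr 1
  · refine Finset.sum_congr rfl fun i _ => ?_
    have : (X *ᵥ (√(N p) • ξ p)) i / √(N p) = (X *ᵥ ξ p) i := by
      rw [mulVec_smul, Pi.smul_apply, smul_eq_mul]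
      field_simp
    rw [meanVec_add (hθ₀ p), ha, this]
  · refine Finset.sum_congr rfl fun i _ => ?_
    rw [Real.norm_eq_abs, sq_abs, PiLp.sub_apply, scaledDesign_apply]

theorem tendsto_count_atTop (hm : ∀ i, 0 < mstar i) (hN : Tendsto N l atTop)
    (hw : w =O[l] fun _ => (1 : ℝ))
    (ha : ∀ p i, a p i = N p * mstar i + √(N p) * √(mstar i) * w p i) (i : Fin k) :
    Tendsto (fun p => a p i) l atTop := by
  have h1 : Tendsto (fun p => mstar i * (1 + w p i / √(N p) / √(mstar i))) l (𝓝 (mstar i)) := by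
    simpa using (((tendsto_div_sqrt_zero hN (isBigO_coord hw i)).div_const
      (√(mstar i))).const_add 1).const_mul (mstar i)
  refine (hN.atTop_mul_pos (hm i) h1).congr' ?_
  filter_upwards [hN.eventually_gt_atTop 0] with p hp
  rw [ha, add_sqrt_mul_eq hp (hm i), mul_assoc]

/-- Dividing by `N` yields a constraint map independent of the index, so one implicit function
serves the whole sequence. -/
theorem mem_constraint_iff {κ : Type*} {L : Matrix (Fin k) κ ℝ} {θ₀ ξ : Fin t → ℝ} {N : ℝ} (hN : N ≠ 0)
    (h : meanVec X θ₀ = N • mstar) :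
    Lᵀ *ᵥ meanVec X (θ₀ + ξ) = Lᵀ *ᵥ meanVec X θ₀ ↔
      (Lᵀ *ᵥ fun i => mstar i * Real.exp ((X *ᵥ ξ) i)) =
        Lᵀ *ᵥ fun i => mstar i * Real.exp ((X *ᵥ (0 : Fin t → ℝ)) i) := by
  have h1 : meanVec X (θ₀ + ξ) = N • fun i => mstar i * Real.exp ((X *ᵥ ξ) i) := by
    ext i
    rw [meanVec_add h, Pi.smul_apply, smul_eq_mul, mul_assoc]
  have h2 : meanVec X θ₀ = N • fun i => mstar i * Real.exp ((X *ᵥ (0 : Fin t → ℝ)) i) := by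
    rw [h]; simp
  rw [h1, h2, mulVec_smul, mulVec_smul]
  exact smul_right_inj hN

variable {κ : Type*} [Fintype κ] {L : Matrix (Fin k) κ ℝ} {n : ι → Fin k → ℕ}
  {θhat : ι → Fin t → ℝ} {Θ : ι → Set (Fin t → ℝ)}

/-- Along any sequence of tables whose standardized counts stay bounded, the goodness-of-fit
statistic is asymptotically the squared distance of the standardized counts to the tangent space. -/
theorem exists_testStat_tendsto {φ₁ φ₂ : ℝ → EReal} (hφ₁ : IsPhi φ₁) (hφ₂ : IsPhi φ₂)
    (hX : Function.Injective X.mulVec) (hm : ∀ i, 0 < mstar i)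
    (hreg : LinearMap.range (constraintDeriv X L mstar) = ⊤)
    (hN : Tendsto N l atTop) (hθ₀ : ∀ p, meanVec X (θ₀ p) = N p • mstar)
    (hw : w =O[l] fun _ => (1 : ℝ))
    (hn : ∀ p i, realTable (n p) i = N p * mstar i + √(N p) * √(mstar i) * w p i)
    (hΘ : ∀ p, Θ p = {θ | Lᵀ *ᵥ meanVec X θ = Lᵀ *ᵥ meanVec X (θ₀ p)})
    (hθhat : ∀ p, (∃ θ, θ ∈ Θ p ∧
        IsMinOn (fun θ => phiDiv φ₂ (realTable (n p)) (meanVec X θ)) (Θ p) θ) →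
      θhat p ∈ Θ p ∧
        IsMinOn (fun θ => phiDiv φ₂ (realTable (n p)) (meanVec X θ)) (Θ p) (θhat p)) :
    ∃ T : ι → ℝ, (∀ᶠ p in l, testStat φ₁ X (n p) (θhat p) = (T p : EReal)) ∧
      Tendsto (fun p => T p - ‖w p - (tangentSpace X L mstar).starProjection (w p)‖ ^ 2) l (𝓝 0) := by
  set A := scaledDesign X mstar with hA
  set V := tangentSpace X L mstar with hV
  have hs : Tendsto (fun p => √(N p)) l atTop := Real.tendsto_sqrt_atTop.comp hN
  have hN0 := hN.eventually_gt_atTop 0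
  have hapos : ∀ᶠ p in l, ∀ i, 0 < realTable (n p) i := eventually_all.2 fun i =>
    (tendsto_count_atTop hm hN hw hn i).eventually_gt_atTop 0
  -- the divergence at the true parameter is bounded
  have hD0 : (fun p => realDiv φ₂ (realTable (n p)) (meanVec X (θ₀ p))) =O[l] fun _ => (1 : ℝ) := by
    have h1 := tendsto_realDiv_sub hφ₂ hm hN hθ₀ hw hn (ξ := fun _ => 0) (by
      simpa only [smul_zero] using isBigO_zero (fun _ => (1 : ℝ)) l)
    simp only [add_zero, smul_zero, map_zero, sub_zero] at h1
    have h2 := ((isLittleO_one_iff ℝ).2 h1).isBigO.add ((hw.norm_left.pow 2).congr_right fun _ => one_pow 2)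
    refine (h2.const_mul_left (phiSecond φ₂ / 2)).congr_left fun p => ?_
    have := hφ₂.phiSecond_pos
    field_simp
    ring
  have hmem0 : ∀ p, θ₀ p ∈ Θ p := fun p => by rw [hΘ]; exact Set.mem_ofPred_eq ▸ rfl
  -- the minimizer exists eventually
  have hhat : ∀ᶠ p in l, θhat p ∈ Θ p ∧ ∀ θ ∈ Θ p,
      realDiv φ₂ (realTable (n p)) (meanVec X (θhat p)) ≤ realDiv φ₂ (realTable (n p)) (meanVec X θ) := by
    obtain ⟨c, hc, hcoer⟩ := hφ₂.exists_coercive (show (0 : ℝ) < 1 / 2 by norm_num)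
    obtain ⟨B, hB⟩ := hD0.bound
    -- The divergence at `θ₀` is at most `B`, hence at most `c` times every count that reaches `B /
    -- c`, as the existence lemma requires.
    have hbig : ∀ᶠ p in l, ∀ i, B / c ≤ realTable (n p) i := eventually_all.2 fun i =>
      (tendsto_count_atTop hm hN hw hn i).eventually_ge_atTop _
    filter_upwards [hapos, hB, hbig] with p hpos hBp hbigp
    have hcl : IsClosed (Θ p) := by
      rw [hΘ]
      exact isClosed_eq ((LinearMap.continuous_of_finiteDimensional Lᵀ.mulVecLin).comp
        (continuous_meanVec X)) continuous_const
    obtain ⟨θ, hθ, hmin⟩ := exists_isMinOn_realDiv hφ₂ hX hpos hcl hcoer (hmem0 p) (fun i => by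
      have h1 := hbigp i
      rw [div_le_iff₀ hc] at h1
      have h2 := (le_abs_self _).trans hBp
      rw [norm_one, mul_one] at h2
      linarith)
    have hE : ∀ θ, phiDiv φ₂ (realTable (n p)) (meanVec X θ) =
        (realDiv φ₂ (realTable (n p)) (meanVec X θ) : ℝ) := fun θ =>
      phiDiv_eq_realDiv hφ₂ hpos (meanVec_pos X θ)
    obtain ⟨h1, h2⟩ := hθhat p ⟨θ, hθ, fun θ' hθ' => by
      simp only [hE]
      exact EReal.coe_le_coe_iff.2 (hmin hθ')⟩
    refine ⟨h1, fun θ' hθ' => ?_⟩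
    have := h2 hθ'
    simp only [hE] at this
    exact EReal.coe_le_coe_iff.1 this
  -- the minimizer is `√N`-consistent
  set ξ : ι → Fin t → ℝ := fun p => θhat p - θ₀ p with hξdef
  have hξadd : ∀ p, θ₀ p + ξ p = θhat p := fun p => by simp [hξdef]
  have hξ : (fun p => √(N p) • ξ p) =O[l] fun _ => (1 : ℝ) := by
    have h1 : (fun p => X.mulVecLin (√(N p) • ξ p)) =O[l] fun _ => (1 : ℝ) := by
      refine isBigO_pi_one.2 fun i => ?_
      have := isBigO_log_ratio hφ₂ (hm i) hN (isBigO_coord hw i) hD0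
        (x := fun p => (X *ᵥ ξ p) i) (by
          filter_upwards [hapos, hhat] with p hpos hp
          have h2 := mul_realPhi_le_realDiv hφ₂ hpos (meanVec_pos X (θhat p)) i
          rw [← hξadd p, meanVec_add (hθ₀ p), hn, hξadd p] at h2
          exact h2.trans (hp.2 _ (hmem0 p)))
      simpa [mulVec_smul] using this
    obtain ⟨g, hg⟩ := X.mulVecLin.exists_leftInverse_of_injective (LinearMap.ker_eq_bot.2 hX)
    refine ((isBigO_clm_comp g _).trans h1).congr_left fun p => ?_
    exact LinearMap.congr_fun hg _
  have hG := hasStrictFDerivAt_constraint X L mstar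
  have hξG : ∀ᶠ p in l, (Lᵀ *ᵥ fun i => mstar i * Real.exp ((X *ᵥ ξ p) i)) =
      Lᵀ *ᵥ fun i => mstar i * Real.exp ((X *ᵥ (0 : Fin t → ℝ)) i) := by
    filter_upwards [hhat, hN0] with p hp hNp
    have := hp.1
    rw [hΘ, Set.mem_ofPred_eq] at this
    rw [← mem_constraint_iff hNp.ne' (hθ₀ p), hξadd]
    exact this
  have hprojO : (fun p => V.starProjection (w p)) =O[l] fun _ => (1 : ℝ) :=
    (V.starProjection.isBigO_comp w l).trans hw
  have hT1 := tendsto_realDiv_sub hφ₁ hm hN hθ₀ hw hn hξ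
  have hT2 := tendsto_realDiv_sub hφ₂ hm hN hθ₀ hw hn hξ
  -- lower bound
  obtain ⟨η, hη0, hη⟩ := exists_ker_tendsto_sub hreg
    (tendsto_deriv_of_eq hG.hasFDerivAt hs hξ hξG)
  have hAη : Tendsto (fun p => A (√(N p) • ξ p) - A (η p)) l (𝓝 0) := by
    simpa [Function.comp_def] using
      ((LinearMap.toContinuousLinearMap A).continuous.tendsto 0).comp hη
  have hlow := tendsto_norm_sq_sub (u := fun p => w p - A (√(N p) • ξ p))
    (u' := fun p => w p - A (η p)) (hw.sub ((isBigO_clm_comp A _).trans hξ)) (by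
      simpa using hAη.neg)
  have hlow' : ∀ p, ‖w p - V.starProjection (w p)‖ ^ 2 ≤ ‖w p - A (η p)‖ ^ 2 := fun p => by
    gcongr
    rw [V.starProjection_minimal]
    exact ciInf_le ⟨0, by rintro _ ⟨x, rfl⟩; exact norm_nonneg _⟩
      (⟨A (η p), Submodule.mem_map_of_mem (hη0 p)⟩ : V)
  -- upper bound
  obtain ⟨g, hg⟩ := A.exists_leftInverse_of_injective
    (LinearMap.ker_eq_bot.2 (scaledDesign_injective hX hm))
  have hgV : ∀ v ∈ V, A (g v) = v ∧ constraintDeriv X L mstar (g v) = 0 := by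
    rintro _ ⟨η, hη, rfl⟩
    have : g (A η) = η := LinearMap.congr_fun hg η
    rw [this]
    exact ⟨rfl, hη⟩
  obtain ⟨ζ, hζG, hζ⟩ := exists_tangent_solution hG hreg hs
    (u := fun p => g (V.starProjection (w p))) ((isBigO_clm_comp g _).trans hprojO)
    (fun p => (hgV _ (V.starProjection_apply_mem _)).2)
  have hζO : (fun p => √(N p) • ζ p) =O[l] fun _ => (1 : ℝ) := by
    have h1 := ((isLittleO_one_iff ℝ).2 hζ).isBigO.add ((isBigO_clm_comp g _).trans hprojO)
    simpa using h1
  have hT3 := tendsto_realDiv_sub hφ₂ hm hN hθ₀ hw hn hζO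
  have hAζ : Tendsto (fun p => A (√(N p) • ζ p) - V.starProjection (w p)) l (𝓝 0) := by
    have := ((LinearMap.toContinuousLinearMap A).continuous.tendsto 0).comp hζ
    simp only [map_zero] at this
    refine this.congr fun p => ?_
    simp only [Function.comp, LinearMap.coe_toContinuousLinearMap', map_sub]
    rw [(hgV _ (V.starProjection_apply_mem (w p))).1]
  have hup := tendsto_norm_sq_sub (u := fun p => w p - A (√(N p) • ζ p))
    (u' := fun p => w p - V.starProjection (w p)) (hw.sub ((isBigO_clm_comp A _).trans hζO)) (by
      simpa using hAζ.neg)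
  have hup' : ∀ᶠ p in l, 2 / phiSecond φ₂ * realDiv φ₂ (realTable (n p)) (meanVec X (θ₀ p + ξ p)) ≤
      2 / phiSecond φ₂ * realDiv φ₂ (realTable (n p)) (meanVec X (θ₀ p + ζ p)) := by
    filter_upwards [hhat, hN0, hζG] with p hp hNp hζp
    have := hφ₂.phiSecond_pos
    rw [hξadd]
    gcongr
    refine hp.2 _ ?_
    rw [hΘ, Set.mem_ofPred_eq]
    exact (mem_constraint_iff hNp.ne' (hθ₀ p)).2 hζp
  refine ⟨fun p => 2 / phiSecond φ₁ * realDiv φ₁ (realTable (n p)) (meanVec X (θ₀ p + ξ p)), ?_, ?_⟩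
  · filter_upwards [hapos] with p hpos
    rw [testStat, phiDiv_eq_realDiv hφ₁ hpos (meanVec_pos X _), hξadd, EReal.coe_mul]
  -- Lower bound: compare with the point `A η` of `V`. Upper bound: pass from `φ₁` to `φ₂` at the
  -- minimizer by `h12`, then by minimality to the tangent competitor `ζ`.
  · have h12 := hT1.sub hT2
    refine tendsto_of_tendsto_of_tendsto_of_le_of_le' (by simpa using hT1.add hlow)
      (by simpa using (h12.add hT3).add hup) ?_ ?_
    · filter_upwards with p
      have := hlow' p
      linarith
    · filter_upwards [hup'] with p hp
      linarith

end Asymptotic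

/-! ### The law of the table and its Fourier transform -/

/-- The multinomial theorem in exponential form. -/
theorem sum_piAntidiag_prod_pow_div_factorial {α : Type*} [DecidableEq α] (s : Finset α) (x : α → ℂ)
    (M : ℕ) : ∑ g ∈ s.piAntidiag M, ∏ i ∈ s, x i ^ g i / (g i).factorial =
      (∑ i ∈ s, x i) ^ M / M.factorial := by
  rw [Finset.sum_pow_eq_sum_piAntidiag, Finset.sum_div]
  refine Finset.sum_congr rfl fun g hg => ?_
  have h1 := Nat.multinomial_spec s g
  rw [(Finset.mem_piAntidiag.1 hg).1] at h1
  have h2 : (∏ i ∈ s, ((g i).factorial : ℂ)) ≠ 0 :=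
    Finset.prod_ne_zero_iff.2 fun i _ => by exact_mod_cast (g i).factorial_ne_zero
  have h3 : (M.factorial : ℂ) ≠ 0 := by exact_mod_cast M.factorial_ne_zero
  rw [Finset.prod_div_distrib, div_eq_div_iff h2 h3, ← h1]
  push_cast
  ring

/-- The product-multinomial theorem in exponential form. -/
theorem sum_prod_pow_div_factorial_of_block {α β : Type*} [Fintype α] [DecidableEq α] [Fintype β]
    [DecidableEq β] (b : α → β) (M : β → ℕ) (x : α → ℂ) (A : Finset (α → ℕ))
    (hA : ∀ n, n ∈ A ↔ ∀ h, ∑ i with b i = h, n i = M h) :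
    ∑ n ∈ A, ∏ i, x i ^ n i / (n i).factorial =
      ∏ h, (∑ i with b i = h, x i) ^ M h / (M h).factorial := by
  simp_rw [← sum_piAntidiag_prod_pow_div_factorial]
  rw [Finset.prod_univ_sum]
  symm
  -- A table corresponds to the family of its restrictions to the blocks, each extended by zero.
  refine Finset.sum_bij' (fun p _ i => p (b i) i) (fun n _ h i => if b i = h then n i else 0)
    (fun p hp => ?_) (fun n hn => ?_) (fun p hp => ?_) (fun n hn => ?_) (fun p hp => ?_)
  · rw [hA]
    intro h
    rw [← (Finset.mem_piAntidiag.1 (Fintype.mem_piFinset.1 hp h)).1]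
    exact Finset.sum_congr rfl fun i hi => by rw [(Finset.mem_filter.1 hi).2]
  · refine Fintype.mem_piFinset.2 fun h => Finset.mem_piAntidiag.2 ⟨?_, fun i => ?_⟩
    · rw [← (hA n).1 hn h]
      exact Finset.sum_congr rfl fun i hi => by rw [if_pos (Finset.mem_filter.1 hi).2]
    · simp +contextual
  · funext h i
    by_cases hbi : b i = h
    · simp [hbi]
    · rw [if_neg hbi]
      by_contra hne
      have := (Finset.mem_piAntidiag.1 (Fintype.mem_piFinset.1 hp h)).2 i (Ne.symm hne)
      exact hbi (Finset.mem_filter.1 this).2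
  · funext i
    simp
  · rw [← Finset.prod_fiberwise (g := b)]
    refine Finset.prod_congr rfl fun h _ => Finset.prod_congr rfl fun i hi => ?_
    obtain rfl := (Finset.mem_filter.1 hi).2
    rfl

section Law

variable {k c : ℕ}

theorem samplingMatrix_transpose_mulVec (block : 0 < c → Fin k → Fin c) (hc : 0 < c)
    (v : Fin k → ℝ) (h : Fin c) :
    ((samplingMatrix block)ᵀ *ᵥ v) h = ∑ i with block hc i = h, v i := by
  simp only [mulVec, dotProduct, transpose_apply, samplingMatrix, of_apply, ite_mul, one_mul,
    zero_mul, Finset.sum_filter]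

theorem integral_pi_poisson_eq_prod {m : Fin k → ℝ} (ζ : Fin k → ℝ) :
    ∫ n, ∏ i, Complex.exp (ζ i * n i * Complex.I)
      ∂(Measure.pi fun i => poissonMeasure (Real.toNNReal (m i))) =
      ∏ i, Complex.exp (Real.toNNReal (m i) * (Complex.exp (ζ i * Complex.I) - 1)) := by
  rw [integral_fintype_prod_eq_prod (𝕜 := ℂ)
    (f := fun i (n : ℕ) => Complex.exp (ζ i * n * Complex.I))]
  refine Finset.prod_congr rfl fun i _ => ?_
  have := charFun_map_cast_poissonMeasure (Real.toNNReal (m i)) (ζ i)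
  rw [charFun_apply_real, integral_map (by fun_prop) (by fun_prop)] at this
  simpa using this

theorem pi_poisson_real_singleton {m : Fin k → ℝ} (hm : ∀ i, 0 < m i) (n : Fin k → ℕ) :
    (Measure.pi fun i => poissonMeasure (Real.toNNReal (m i))).real {n} =
      ∏ i, (Real.exp (-m i) * m i ^ n i / (n i).factorial) := by
  rw [measureReal_def, Measure.pi_singleton, ENNReal.toReal_prod]
  refine Finset.prod_congr rfl fun i _ => ?_
  rw [← measureReal_def, poissonMeasure_real_singleton, Real.coe_toNNReal _ (hm i).le]

theorem setOf_block_finite (b : Fin k → Fin c) (M : Fin c → ℕ) :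
    {n : Fin k → ℕ | ∀ h, ∑ i with b i = h, n i = M h}.Finite := by
  refine (Set.finite_Icc 0 fun i => M (b i)).subset fun n hn => ⟨fun i => Nat.zero_le _, fun i => ?_⟩
  show n i ≤ M (b i)
  have h := Set.mem_ofPred_eq ▸ hn
  rw [← h (b i)]
  exact Finset.single_le_sum (f := n) (fun _ _ => Nat.zero_le _) (by simp)

theorem setOf_totals_eq (block : 0 < c → Fin k → Fin c) (hc : 0 < c) {m : Fin k → ℝ} {M : Fin c → ℕ}
    (hM : ∀ h, ((samplingMatrix block)ᵀ *ᵥ m) h = M h) :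
    {n : Fin k → ℕ | (samplingMatrix block)ᵀ *ᵥ realTable n = (samplingMatrix block)ᵀ *ᵥ m} =
      {n | ∀ h, ∑ i with block hc i = h, n i = M h} := by
  ext n
  simp only [Set.mem_ofPred_eq, funext_iff, hM, samplingMatrix_transpose_mulVec block hc, realTable]
  exact forall_congr' fun h => by exact_mod_cast Iff.rfl

/-- Prescribed totals leave finitely many tables, and the phases turn each `mᵢ` into `mᵢ exp(i ζᵢ)`
in the product-multinomial identity. -/
theorem setIntegral_block (b : Fin k → Fin c) {m : Fin k → ℝ} (hm : ∀ i, 0 < m i) (M : Fin c → ℕ)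
    (ζ : Fin k → ℝ) :
    ∫ n in {n : Fin k → ℕ | ∀ h, ∑ i with b i = h, n i = M h},
      ∏ i, Complex.exp (ζ i * n i * Complex.I)
      ∂(Measure.pi fun i => poissonMeasure (Real.toNNReal (m i))) =
      (∏ i, Complex.exp (-m i)) *
        ∏ h, (∑ i with b i = h, m i * Complex.exp (ζ i * Complex.I)) ^ M h / (M h).factorial := by
  have hfin := setOf_block_finite b M
  obtain ⟨A, hA⟩ := hfin.exists_finset_coe
  rw [← hA, ← sum_prod_pow_div_factorial_of_block b M _ A (fun n => by
    rw [← Finset.mem_coe, hA, Set.mem_ofPred_eq]), setIntegral_finset _ IntegrableOn.finset,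
    Finset.mul_sum]
  refine Finset.sum_congr rfl fun n _ => ?_
  rw [pi_poisson_real_singleton hm, Complex.real_smul, Complex.ofReal_prod,
    ← Finset.prod_mul_distrib, ← Finset.prod_mul_distrib]
  refine Finset.prod_congr rfl fun i _ => ?_
  rw [mul_pow, ← Complex.exp_nat_mul]
  push_cast
  rw [show (n i : ℂ) * (ζ i * Complex.I) = ζ i * n i * Complex.I by ring]
  ring

/-- Divide the unnormalized integral by its value at `ζ = 0`; the exponentials and factorials
cancel. That this value is nonzero also shows that the conditioning event has positive probability.
-/
theorem integral_dataLaw_block (block : 0 < c → Fin k → Fin c) (hc : 0 < c) {m : Fin k → ℝ}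
    (hm : ∀ i, 0 < m i) {M : Fin c → ℕ} (hM : ∀ h, ((samplingMatrix block)ᵀ *ᵥ m) h = M h)
    (ζ : Fin k → ℝ) :
    ∫ n, ∏ i, Complex.exp (ζ i * n i * Complex.I) ∂(dataLaw (samplingMatrix block) m) =
      ∏ h, ((∑ i with block hc i = h, m i * Complex.exp (ζ i * Complex.I)) / M h) ^ M h ∧
    IsProbabilityMeasure (dataLaw (samplingMatrix block) m) := by
  set μ := Measure.pi fun i => poissonMeasure (Real.toNNReal (m i)) with hμ
  set A := {n : Fin k → ℕ | ∀ h, ∑ i with block hc i = h, n i = M h} with hA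
  have hlaw : dataLaw (samplingMatrix block) m = (μ A)⁻¹ • μ.restrict A := by
    rw [dataLaw, setOf_totals_eq block hc hM, ProbabilityTheory.cond]
  have hMs : ∀ h, (∑ i with block hc i = h, (m i : ℂ)) = M h := fun h => by
    rw [← Complex.ofReal_sum, ← samplingMatrix_transpose_mulVec block hc, hM]
    simp
  have hone := setIntegral_block (block hc) hm M 0
  simp only [Pi.zero_apply, Complex.ofReal_zero, zero_mul, Complex.exp_zero, Finset.prod_const_one,
    integral_const, mul_one, hMs] at hone
  have hexp : (∏ i, Complex.exp (-m i)) ≠ 0 := Finset.prod_ne_zero_iff.2 fun i _ => Complex.exp_ne_zero _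
  have hpow : ∀ h, ((M h : ℂ) ^ M h / (M h).factorial) ≠ 0 := fun h => by
    refine div_ne_zero ?_ (by exact_mod_cast (M h).factorial_ne_zero)
    -- A subtable with total `0` contributes `0 ^ 0 = 1`.
    by_cases h0 : M h = 0
    · simp [h0]
    · exact pow_ne_zero _ (by exact_mod_cast h0)
  have hprod : (∏ h, ((M h : ℂ) ^ M h / (M h).factorial)) ≠ 0 :=
    Finset.prod_ne_zero_iff.2 fun h _ => hpow h
  have hA' : ((μ.real A : ℝ) : ℂ) = (∏ i, Complex.exp (-m i)) * ∏ h, ((M h : ℂ) ^ M h / (M h).factorial) := by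
    rw [← hone]
    simp [measureReal_restrict_apply, hA, hμ]
  have hAne : μ.real A ≠ 0 := by
    intro h0
    rw [h0, Complex.ofReal_zero] at hA'
    exact mul_ne_zero hexp hprod hA'.symm
  constructor
  · rw [hlaw, integral_smul_measure, ENNReal.toReal_inv, ← measureReal_def, hA, setIntegral_block (block hc) hm M ζ,
      ← hA, Complex.real_smul, Complex.ofReal_inv, hA', mul_inv, ← mul_assoc, mul_comm (_ * _) (∏ i, Complex.exp (-m i)),
      ← mul_assoc, mul_inv_cancel₀ hexp, one_mul, ← Finset.prod_inv_distrib, ← Finset.prod_mul_distrib]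
    refine Finset.prod_congr rfl fun h _ => ?_
    have hf : ((M h).factorial : ℂ) ≠ 0 := by exact_mod_cast (M h).factorial_ne_zero
    rw [div_pow, inv_div, div_mul_div_comm, mul_comm ((M h).factorial : ℂ), mul_div_mul_right _ _ hf]
  · rw [dataLaw, setOf_totals_eq block hc hM]
    refine cond_isProbabilityMeasure fun h0 => hAne ?_
    rw [measureReal_def, hμ, hA, h0, ENNReal.toReal_zero]

end Law

/-! ### Convergence of characteristic functions -/

/-- The second-order term of the cumulant of a standardized Poisson count. -/
theorem tendsto_mul_exp_sub {μ : ℝ} (hμ : 0 < μ) (u : ℝ) :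
    Tendsto (fun x : ℝ => ((x * μ : ℝ) : ℂ) * (Complex.exp ((u / √(x * μ) : ℝ) * Complex.I) - 1 -
      (u / √(x * μ) : ℝ) * Complex.I)) atTop (𝓝 (-(u : ℂ) ^ 2 / 2)) := by
  have hx : Tendsto (fun x : ℝ => √(x * μ)) atTop atTop :=
    Real.tendsto_sqrt_atTop.comp (tendsto_id.atTop_mul_const hμ)
  set z : ℝ → ℂ := fun x => ((u / √(x * μ) : ℝ) : ℂ) * Complex.I with hz
  have hz0 : Tendsto z atTop (𝓝 0) := by
    have h1 : Tendsto (fun x : ℝ => ((u / √(x * μ) : ℝ) : ℂ)) atTop (𝓝 0) := by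
      simpa [Function.comp_def] using (Complex.continuous_ofReal.tendsto 0).comp (hx.const_div_atTop u)
    simpa [hz] using h1.mul_const Complex.I
  have h1 : (fun w : ℂ => Complex.exp w - 1 - w - w ^ 2 / 2) =o[𝓝 0] fun w => w ^ 2 := by
    have h2 := (Complex.exp_sub_sum_range_isBigO_pow 3).trans_isLittleO
      (isLittleO_pow_pow (𝕜 := ℂ) (show 2 < 3 by norm_num))
    refine h2.congr_left fun w => ?_
    simp [Finset.sum_range_succ]
    ring
  have h2 := (isBigO_refl (fun x : ℝ => ((x * μ : ℝ) : ℂ)) atTop).mul_isLittleO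
    (h1.comp_tendsto hz0)
  have hsq : ∀ᶠ x : ℝ in atTop, ((x * μ : ℝ) : ℂ) * z x ^ 2 = -(u : ℂ) ^ 2 := by
    filter_upwards [eventually_gt_atTop 0] with x hx
    have h3 : 0 < x * μ := mul_pos hx hμ
    have h4 : (x * μ) * (u / √(x * μ)) ^ 2 = u ^ 2 := by
      rw [div_pow, Real.sq_sqrt h3.le]
      field_simp
    rw [hz, mul_pow, Complex.I_sq, mul_neg_one, mul_neg, ← Complex.ofReal_pow, ← Complex.ofReal_mul, h4]
    simp
  have h3 : Tendsto (fun x : ℝ => ((x * μ : ℝ) : ℂ) *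
      (Complex.exp (z x) - 1 - z x - z x ^ 2 / 2)) atTop (𝓝 0) := by
    refine (isLittleO_one_iff ℂ).1 (h2.trans_isBigO ?_)
    refine IsBigO.congr' (isBigO_const_const (-(u : ℂ) ^ 2) (one_ne_zero (α := ℂ)) atTop) ?_ EventuallyEq.rfl
    filter_upwards [hsq] with x hx using hx.symm
  have h4 := h3.add_const (-(u : ℂ) ^ 2 / 2)
  rw [zero_add] at h4
  refine h4.congr' ?_
  filter_upwards [hsq] with x hx
  linear_combination -hx / 2

theorem mul_mul_div_sqrt {N m : ℝ} (hN : 0 < N) (u : ℝ) :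
    N * m * (u / √(N * m)) = √N * (√m * u) := by
  rw [mul_div_left_comm, Real.div_sqrt, Real.sqrt_mul hN.le]
  ring

section CharFun

variable {k c : ℕ}

/-- The standardized table of counts. -/
noncomputable def stdCount (mstar : Fin k → ℝ) (N : ℝ) (n : Fin k → ℕ) : EuclideanSpace ℝ (Fin k) :=
  WithLp.toLp 2 fun i => (n i - N * mstar i) / (√N * √(mstar i))

/-- Separates the deterministic centring phase from the product over cells, whose integral is known
explicitly. -/
theorem exp_inner_stdCount {mstar : Fin k → ℝ} (hm : ∀ i, 0 < mstar i) {N : ℝ} (hN : 0 < N)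
    (u : EuclideanSpace ℝ (Fin k)) (n : Fin k → ℕ) :
    Complex.exp (inner ℝ (stdCount mstar N n) u * Complex.I) =
      Complex.exp (-(∑ i, ((N * mstar i : ℝ) : ℂ) * ((u i / √(N * mstar i) : ℝ) * Complex.I))) *
        ∏ i, Complex.exp ((u i / √(N * mstar i) : ℝ) * n i * Complex.I) := by
  rw [← Complex.exp_sum, ← Complex.exp_add, PiLp.inner_apply, ← Finset.sum_neg_distrib,
    ← Finset.sum_add_distrib, Complex.ofReal_sum, Finset.sum_mul]
  congr 1
  refine Finset.sum_congr rfl fun i _ => ?_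
  have h1 : inner ℝ (stdCount mstar N n i) (u i) =
      -(N * mstar i * (u i / √(N * mstar i))) + u i / √(N * mstar i) * n i := by
    rw [Real.sqrt_mul hN.le]
    have := Real.sqrt_pos.2 hN
    have := Real.sqrt_pos.2 (hm i)
    simp only [stdCount, RCLike.inner_apply, conj_trivial]
    field_simp
    ring
  rw [h1]
  push_cast
  ring

theorem isProbabilityMeasure_dataLaw (block : 0 < c → Fin k → Fin c) {m : Fin k → ℝ}
    (hm : ∀ i, 0 < m i) (hM : ∀ h, ∃ M : ℕ, ((samplingMatrix block)ᵀ *ᵥ m) h = M) :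
    IsProbabilityMeasure (dataLaw (samplingMatrix block) m) := by
  choose M hM using hM
  rcases Nat.eq_zero_or_pos c with rfl | hc
  · refine cond_isProbabilityMeasure ?_
    rw [show {n : Fin k → ℕ | (samplingMatrix block)ᵀ *ᵥ realTable n = (samplingMatrix block)ᵀ *ᵥ m} =
      Set.univ from Set.eq_univ_of_forall fun n => Subsingleton.elim (α := Fin 0 → ℝ) _ _]
    simp
  · exact (integral_dataLaw_block block hc hm hM 0).2

/-- The base equals `1 + g(M)`: the linear terms cancel by `hu`, and the quadratic ones give `M g(M)
→ ∑ -uᵢ² / 2`, so `(1 + g(M)) ^ M` tends to the exponential. An empty block has `M = 0`, and both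
sides are `1`. -/
theorem tendsto_block_factor {s : Finset (Fin k)} {mstar : Fin k → ℝ} (hm : ∀ i, 0 < mstar i)
    {u : Fin k → ℝ} (hu : ∑ i ∈ s, √(mstar i) * u i = 0) {N : ℕ → ℝ} (hN : Tendsto N atTop atTop)
    {M : ℕ → ℕ} (hM : ∀ ν, ∑ i ∈ s, N ν * mstar i = M ν) :
    Tendsto (fun ν => ((∑ i ∈ s, ((N ν * mstar i : ℝ) : ℂ) *
        Complex.exp ((u i / √(N ν * mstar i) : ℝ) * Complex.I)) / M ν) ^ M ν) atTop
      (𝓝 (Complex.exp (∑ i ∈ s, -(u i : ℂ) ^ 2 / 2))) := by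
  rcases s.eq_empty_or_nonempty with rfl | hs
  · have : ∀ ν, M ν = 0 := fun ν => by simpa using (hM ν).symm
    simp [this]
  set P := ∑ i ∈ s, mstar i with hP
  have hP0 : 0 < P := Finset.sum_pos (fun i _ => hm i) hs
  have hMN : ∀ ν, N ν * P = M ν := fun ν => by rw [hP, Finset.mul_sum, hM]
  have hMtop : Tendsto M atTop atTop := by
    rw [← tendsto_natCast_atTop_iff (R := ℝ)]
    simpa [← hMN] using hN.atTop_mul_const hP0
  set g : ℕ → ℂ := fun M => ∑ i ∈ s, ((mstar i / P : ℝ) : ℂ) *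
    (Complex.exp ((u i / √(M * (mstar i / P)) : ℝ) * Complex.I) - 1 -
      (u i / √(M * (mstar i / P)) : ℝ) * Complex.I) with hg
  have hlim : Tendsto (fun M : ℕ => (M : ℂ) * g M) atTop (𝓝 (∑ i ∈ s, -(u i : ℂ) ^ 2 / 2)) := by
    have h1 := tendsto_finsetSum s fun i _ =>
      (tendsto_mul_exp_sub (div_pos (hm i) hP0) (u i)).comp tendsto_natCast_atTop_atTop
    refine h1.congr fun M => ?_
    rw [hg, Finset.mul_sum]
    refine Finset.sum_congr rfl fun i _ => ?_
    simp only [Function.comp]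
    push_cast
    ring
  refine ((Complex.tendsto_one_add_pow_exp_of_tendsto hlim).comp hMtop).congr' ?_
  filter_upwards [hN.eventually_gt_atTop 0] with ν hν
  have hM0 : (0 : ℝ) < M ν := by rw [← hMN]; positivity
  have hM0' : (M ν : ℂ) ≠ 0 := by exact_mod_cast hM0.ne'
  have hmi : ∀ i, (M ν : ℝ) * (mstar i / P) = N ν * mstar i := fun i => by
    rw [← hMN]; field_simp
  simp only [Function.comp]
  congr 1
  rw [eq_div_iff hM0', add_mul, one_mul, hg, Finset.sum_mul]
  have h1 : (M ν : ℂ) = ∑ i ∈ s, ((N ν * mstar i : ℝ) : ℂ) := by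
    rw [← Complex.ofReal_sum, hM]; simp
  have h2 : ∑ i ∈ s, ((N ν * mstar i : ℝ) : ℂ) * ((u i / √(N ν * mstar i) : ℝ) * Complex.I) = 0 := by
    have h3 : ∑ i ∈ s, (N ν * mstar i) * (u i / √(N ν * mstar i)) = 0 := by
      simp only [mul_mul_div_sqrt hν]
      rw [← Finset.mul_sum, hu, mul_zero]
    simp only [← mul_assoc, ← Finset.sum_mul, ← Complex.ofReal_mul, ← Complex.ofReal_sum]
    rw [h3]; simp
  refine (congrArg (· + _) h1).trans ?_
  rw [← Finset.sum_add_distrib, ← sub_eq_zero, ← Finset.sum_sub_distrib, ← neg_eq_zero.2 h2,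
    ← Finset.sum_neg_distrib]
  refine Finset.sum_congr rfl fun i _ => ?_
  rw [hmi]
  have h7 : ((mstar i / P : ℝ) : ℂ) * M ν = ((N ν * mstar i : ℝ) : ℂ) := by
    rw [← hmi]; push_cast; ring
  linear_combination (Complex.exp ((u i / √(N ν * mstar i) : ℝ) * Complex.I) - 1 -
      (u i / √(N ν * mstar i) : ℝ) * Complex.I) * h7

/-- The characteristic function of the standardized counts converges to that of the standard normal
law in the directions that are orthogonal to the sampling constraints. -/
theorem tendsto_integral_exp_inner_stdCount (block : 0 < c → Fin k → Fin c) {mstar : Fin k → ℝ}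
    (hm : ∀ i, 0 < mstar i) {N : ℕ → ℝ} (hN : Tendsto N atTop atTop)
    (hM : ∀ ν h, ∃ M : ℕ, ((samplingMatrix block)ᵀ *ᵥ (N ν • mstar)) h = M)
    {u : EuclideanSpace ℝ (Fin k)}
    (hu : (samplingMatrix block)ᵀ *ᵥ (fun i => √(mstar i) * u i) = 0) :
    Tendsto (fun ν => ∫ n, Complex.exp (inner ℝ (stdCount mstar (N ν) n) u * Complex.I)
      ∂(dataLaw (samplingMatrix block) (N ν • mstar))) atTop (𝓝 (Complex.exp (-(‖u‖ ^ 2 / 2 : ℝ)))) := by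
  choose M hM using hM
  have hnorm : (-(‖u‖ ^ 2 / 2 : ℝ) : ℂ) = ∑ i, -(u i : ℂ) ^ 2 / 2 := by
    rw [EuclideanSpace.real_norm_sq_eq]
    push_cast
    rw [Finset.sum_div, ← Finset.sum_neg_distrib]
    exact Finset.sum_congr rfl fun i _ => by ring
  have hpos := hN.eventually_gt_atTop 0
  rw [hnorm]
  rcases Nat.eq_zero_or_pos c with rfl | hc
  · have hlaw : ∀ m : Fin k → ℝ, dataLaw (samplingMatrix block) m =
        Measure.pi fun i => poissonMeasure (Real.toNNReal (m i)) := fun m => by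
      rw [dataLaw, show {n : Fin k → ℕ | (samplingMatrix block)ᵀ *ᵥ realTable n =
        (samplingMatrix block)ᵀ *ᵥ m} = Set.univ from
          Set.eq_univ_of_forall fun n => Subsingleton.elim (α := Fin 0 → ℝ) _ _, cond_univ]
    have h1 := (Complex.continuous_exp.tendsto _).comp (tendsto_finsetSum Finset.univ fun i _ =>
      (tendsto_mul_exp_sub (hm i) (u i)).comp hN)
    refine h1.congr' ?_
    filter_upwards [hpos] with ν hν
    simp only [exp_inner_stdCount hm hν]
    rw [integral_const_mul, hlaw, integral_pi_poisson_eq_prod fun i => u i / √(N ν * mstar i),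
      ← Complex.exp_sum, ← Complex.exp_add, Function.comp, ← Finset.sum_neg_distrib,
      ← Finset.sum_add_distrib]
    congr 1
    refine Finset.sum_congr rfl fun i _ => ?_
    have h2 : ((Real.toNNReal ((N ν • mstar) i) : ℝ) : ℂ) = ((N ν * mstar i : ℝ) : ℂ) := by
      rw [Real.coe_toNNReal _ (by simpa using (mul_pos hν (hm i)).le)]
      simp
    rw [h2]
    simp only [Function.comp]
    ring
  · have hu' : ∀ h, ∑ i with block hc i = h, √(mstar i) * u i = 0 := fun h => by
      rw [← samplingMatrix_transpose_mulVec block hc (fun i => √(mstar i) * u i), hu]; rfl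
    have hM' : ∀ ν h, ∑ i with block hc i = h, N ν * mstar i = M ν h := fun ν h => by
      rw [← hM, samplingMatrix_transpose_mulVec block hc]; rfl
    have h1 := tendsto_finsetProd Finset.univ fun h _ =>
      tendsto_block_factor hm (hu' h) hN fun ν => hM' ν h
    rw [← Complex.exp_sum, Finset.sum_fiberwise] at h1
    refine h1.congr' ?_
    filter_upwards [hpos] with ν hν
    have hmpos : ∀ i, 0 < (N ν • mstar) i := fun i => mul_pos hν (hm i)
    -- The centring phase vanishes because `u` satisfies the sampling constraints blockwise.
    have hzero : ∑ i, ((N ν * mstar i : ℝ) : ℂ) * ((u i / √(N ν * mstar i) : ℝ) * Complex.I) = 0 := by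
      simp only [← mul_assoc, ← Finset.sum_mul, ← Complex.ofReal_mul, ← Complex.ofReal_sum]
      simp only [mul_mul_div_sqrt hν]
      rw [← Finset.mul_sum, ← Finset.sum_fiberwise (g := block hc)]
      simp [hu']
    simp only [exp_inner_stdCount hm hν]
    rw [integral_const_mul, (integral_dataLaw_block block hc hmpos (hM ν) fun i => u i / √(N ν * mstar i)).1,
      hzero]
    simp
end CharFun

/-! ### Weak limits and transfer to the statistic -/

instance isProbabilityMeasure_chiSquared (df : ℕ) : IsProbabilityMeasure (chiSquared df) :=
  Measure.isProbabilityMeasure_map (Measurable.aemeasurable (by fun_prop))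

/-- Parseval in the orthonormal basis defining `stdGaussian`. -/
theorem map_norm_sq_stdGaussian {E : Type*} [NormedAddCommGroup E] [InnerProductSpace ℝ E]
    [FiniteDimensional ℝ E] [MeasurableSpace E] [BorelSpace E] :
    (stdGaussian E).map (fun z => ‖z‖ ^ 2) = chiSquared (Module.finrank ℝ E) := by
  rw [stdGaussian, Measure.map_map (by fun_prop) (by fun_prop), chiSquared]
  congr 1
  funext x
  simp only [Function.comp]
  rw [← real_inner_self_eq_norm_sq, (stdOrthonormalBasis ℝ E).orthonormal.inner_sum]
  simp [sq]

/-- The sampling constraints in standardized coordinates. -/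
noncomputable def samplingConstraint {k c : ℕ} (X0 : Matrix (Fin k) (Fin c) ℝ) (mstar : Fin k → ℝ) :
    EuclideanSpace ℝ (Fin k) →ₗ[ℝ] (Fin c → ℝ) :=
  (X0ᵀ * diagonal fun i => √(mstar i)).mulVecLin ∘ₗ
    (WithLp.linearEquiv 2 ℝ (Fin k → ℝ)).toLinearMap

theorem samplingConstraint_apply {k c : ℕ} (X0 : Matrix (Fin k) (Fin c) ℝ) (mstar : Fin k → ℝ)
    (u : EuclideanSpace ℝ (Fin k)) :
    samplingConstraint X0 mstar u = X0ᵀ *ᵥ fun i => √(mstar i) * u i := by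
  have : (diagonal fun i => √(mstar i)) *ᵥ (u.ofLp) = fun i => √(mstar i) * u i := by
    ext i
    rw [mulVec_diagonal]
  rw [← this, mulVec_mulVec]
  rfl

/-- The central limit theorem for the squared length of a projection of the standardized table. -/
theorem tendsto_map_norm_sq_proj {k c : ℕ} (block : 0 < c → Fin k → Fin c) {mstar : Fin k → ℝ}
    (hm : ∀ i, 0 < mstar i) {N : ℕ → ℝ} (hN : Tendsto N atTop atTop)
    (hM : ∀ ν h, ∃ M : ℕ, ((samplingMatrix block)ᵀ *ᵥ (N ν • mstar)) h = M)
    (hP : ∀ ν, IsProbabilityMeasure (dataLaw (samplingMatrix block) (N ν • mstar)))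
    {W : Submodule ℝ (EuclideanSpace ℝ (Fin k))}
    (hW : W ≤ LinearMap.ker (samplingConstraint (samplingMatrix block) mstar))
    {d : ℕ} (hd : Module.finrank ℝ W = d) :
    Tendsto (β := ProbabilityMeasure ℝ) (fun ν => (⟨(dataLaw (samplingMatrix block) (N ν • mstar)).map
        fun n => ‖W.starProjection (stdCount mstar (N ν) n)‖ ^ 2,
        Measure.isProbabilityMeasure_map (measurable_of_countable _).aemeasurable⟩ :
          ProbabilityMeasure ℝ)) atTop
      (𝓝 ⟨chiSquared d, inferInstance⟩) := by
  subst hd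
  set Y : ℕ → (Fin k → ℕ) → W := fun ν n => W.orthogonalProjectionOnto (stdCount mstar (N ν) n) with hY
  have hYm : ∀ ν, Measurable (Y ν) := fun ν => measurable_of_countable _
  have h1 : Tendsto (β := ProbabilityMeasure W) (fun ν => (⟨(dataLaw (samplingMatrix block) (N ν • mstar)).map (Y ν),
      Measure.isProbabilityMeasure_map (hYm ν).aemeasurable⟩ : ProbabilityMeasure W)) atTop
      (𝓝 ⟨stdGaussian W, inferInstance⟩) := by
    -- By Lévy's theorem on `W`: the projection has the same inner product with `s ∈ W` as the
    -- unprojected vector, so directions in `W ≤ U` suffice.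
    refine ProbabilityMeasure.tendsto_of_tendsto_charFun fun s => ?_
    simp only [ProbabilityMeasure.coe_mk, charFun_stdGaussian]
    have h2 := tendsto_integral_exp_inner_stdCount block hm hN hM (u := (s : EuclideanSpace ℝ (Fin k)))
      (by rw [← samplingConstraint_apply]; exact hW s.2)
    rw [show (-(‖s‖ : ℂ) ^ 2 / 2) = (-(‖(s : EuclideanSpace ℝ (Fin k))‖ ^ 2 / 2 : ℝ) : ℂ) by
      push_cast; simp; ring]
    refine h2.congr fun ν => ?_
    rw [charFun_apply, integral_map (hYm ν).aemeasurable (by fun_prop)]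
    refine integral_congr_ae (Eventually.of_forall fun n => ?_)
    simp only [hY]
    rw [Submodule.inner_orthogonalProjectionOnto_eq_of_mem_right]
  have h2 := (ProbabilityMeasure.tendsto_map_of_tendsto_of_continuous _ _ h1
    (f := fun z : W => ‖z‖ ^ 2) (by fun_prop))
  have h3 : (⟨chiSquared (Module.finrank ℝ W), inferInstance⟩ : ProbabilityMeasure ℝ) =
      ProbabilityMeasure.map ⟨stdGaussian W, inferInstance⟩
        (Measurable.aemeasurable (f := fun z : W => ‖z‖ ^ 2) (by fun_prop)) :=
    Subtype.ext map_norm_sq_stdGaussian.symm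
  rw [h3]
  refine h2.congr fun ν => Subtype.ext ?_
  exact Measure.map_map (by fun_prop) (hYm ν)

theorem continuousAt_cdf {μ : Measure ℝ} [IsProbabilityMeasure μ] {x : ℝ} (hx : μ {x} = 0) :
    ContinuousAt (cdf μ) x := by
  rw [(monotone_cdf μ).continuousAt_iff_leftLim_eq_rightLim, StieltjesFunction.rightLim_eq]
  refine le_antisymm ((monotone_cdf μ).leftLim_le le_rfl) ?_
  rw [← measure_cdf μ, StieltjesFunction.measure_singleton, ENNReal.ofReal_eq_zero] at hx
  linarith

/-- The portmanteau theorem for closed sets, as an eventual strict inequality. -/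
theorem eventually_real_lt_of_isClosed {μs : ℕ → ProbabilityMeasure ℝ} {μ : ProbabilityMeasure ℝ}
    (h : Tendsto μs atTop (𝓝 μ)) {F : Set ℝ} (hF : IsClosed F) {a : ℝ}
    (ha : (μ : Measure ℝ).real F < a) : ∀ᶠ ν in atTop, (μs ν : Measure ℝ).real F < a := by
  have h1 := ProbabilityMeasure.limsup_measure_closed_le_of_tendsto h hF
  have h0 : 0 < a := measureReal_nonneg.trans_lt ha
  have h2 : (μ : Measure ℝ) F < ENNReal.ofReal a := by
    rwa [ENNReal.lt_ofReal_iff_toReal_lt (measure_ne_top _ _)]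
  filter_upwards [eventually_lt_of_limsup_lt (h1.trans_lt h2)] with ν hν
  rwa [ENNReal.lt_ofReal_iff_toReal_lt (measure_ne_top _ _)] at hν

theorem eventually_lt_real_of_isOpen {μs : ℕ → ProbabilityMeasure ℝ} {μ : ProbabilityMeasure ℝ}
    (h : Tendsto μs atTop (𝓝 μ)) {G : Set ℝ} (hG : IsOpen G) {a : ℝ}
    (ha : a < (μ : Measure ℝ).real G) : ∀ᶠ ν in atTop, a < (μs ν : Measure ℝ).real G := by
  have h1 := eventually_real_lt_of_isClosed h hG.isClosed_compl (a := 1 - a) (by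
    rw [probReal_compl_eq_one_sub hG.measurableSet]; linarith)
  filter_upwards [h1] with ν hν
  rw [probReal_compl_eq_one_sub hG.measurableSet] at hν
  linarith

/-- A statistic that is uniformly close to a weakly convergent one, on events where a tight sequence
is bounded, has the same limit law. -/
theorem tendsto_real_of_approx {Ω : Type*} [MeasurableSpace Ω] [DiscreteMeasurableSpace Ω]
    {P : ℕ → Measure Ω} [hP : ∀ ν, IsProbabilityMeasure (P ν)]
    {Q R : ℕ → Ω → ℝ} {T : ℕ → Ω → EReal} {A : ℕ → Set Ω} (hA : ∀ ν, ∀ᵐ n ∂(P ν), n ∈ A ν)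
    {χ χ' : ProbabilityMeasure ℝ}
    (hQ : Tendsto (β := ProbabilityMeasure ℝ) (fun ν => (⟨(P ν).map (Q ν), Measure.isProbabilityMeasure_map
      (Measurable.of_discrete).aemeasurable⟩ : ProbabilityMeasure ℝ)) atTop (𝓝 χ))
    (hR : Tendsto (β := ProbabilityMeasure ℝ) (fun ν => (⟨(P ν).map (R ν), Measure.isProbabilityMeasure_map
      (Measurable.of_discrete).aemeasurable⟩ : ProbabilityMeasure ℝ)) atTop (𝓝 χ'))
    (hT : ∀ K ε : ℝ, 0 < ε → ∀ᶠ ν in atTop, ∀ n ∈ A ν, R ν n ≤ K →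
      ∃ τ : ℝ, T ν n = τ ∧ |τ - Q ν n| < ε)
    {x : ℝ} (hx : (χ : Measure ℝ) {x} = 0) :
    Tendsto (fun ν => (P ν).real {n | T ν n ≤ (x : EReal)}) atTop
      (𝓝 ((χ : Measure ℝ).real (Set.Iic x))) := by
  rw [Metric.tendsto_nhds]
  intro δ' hδ'
  obtain ⟨δ, hδ, hδδ⟩ : ∃ δ : ℝ, 0 < δ ∧ δ' = 2 * δ := ⟨δ' / 2, by positivity, by ring⟩
  obtain ⟨ε, hε, hcdf⟩ := Metric.continuousAt_iff.1 (continuousAt_cdf hx) δ hδ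
  have hup := hcdf (x := x + ε / 2) (by rw [Real.dist_eq, abs_lt]; constructor <;> linarith)
  have hlo := hcdf (x := x - ε / 2) (by rw [Real.dist_eq, abs_lt]; constructor <;> linarith)
  rw [Real.dist_eq, abs_lt, cdf_eq_real, cdf_eq_real] at hup hlo
  set F := (χ : Measure ℝ).real (Set.Iic x)
  obtain ⟨K, hK⟩ : ∃ K, (χ' : Measure ℝ).real (Set.Ici K) < δ := by
    have h1 := tendsto_cdf_atTop (χ' : Measure ℝ)
    obtain ⟨K, hK⟩ := (h1.eventually (lt_mem_nhds (show 1 - δ < 1 by linarith))).exists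
    refine ⟨K + 1, ?_⟩
    rw [cdf_eq_real] at hK
    have h2 : (χ' : Measure ℝ).real (Set.Ici (K + 1)) ≤ (χ' : Measure ℝ).real (Set.Iic K)ᶜ :=
      measureReal_mono fun y (hy : K + 1 ≤ y) => by
        simp only [Set.mem_compl_iff, Set.mem_Iic]; linarith
    rw [probReal_compl_eq_one_sub measurableSet_Iic] at h2
    linarith
  have hQm : ∀ ν, Measurable (Q ν) := fun ν => Measurable.of_discrete
  have hRm : ∀ ν, Measurable (R ν) := fun ν => Measurable.of_discrete
  -- An error below `ε / 4` in the statistic fits within the shifts `ε / 2` and `ε / 4` of `x`. One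
  -- `δ` pays for the oscillation of the distribution function and the other for the event `R ≥ K`.
  have e1 := eventually_real_lt_of_isClosed hQ (isClosed_Iic (a := x + ε / 2)) (a := F + δ) (by linarith)
  have e2 := eventually_lt_real_of_isOpen hQ (isOpen_Iio (a := x - ε / 4)) (a := F - δ) (by
    refine lt_of_lt_of_le (by linarith) (measureReal_mono (show Set.Iic (x - ε / 2) ⊆ _ from
      fun y (hy : y ≤ x - ε / 2) => ?_))
    simp only [Set.mem_Iio]; linarith)
  have e3 := eventually_real_lt_of_isClosed hR (isClosed_Ici (a := K)) hK
  filter_upwards [e1, e2, e3, hT K (ε / 4) (by positivity)] with ν h1 h2 h3 h4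
  simp only [ProbabilityMeasure.coe_mk] at h1 h2 h3
  rw [map_measureReal_apply (hQm ν) measurableSet_Iic] at h1
  rw [map_measureReal_apply (hQm ν) measurableSet_Iio] at h2
  rw [map_measureReal_apply (hRm ν) measurableSet_Ici] at h3
  have hnull : (P ν).real (A ν)ᶜ = 0 := by
    rw [measureReal_def, show P ν (A ν)ᶜ = 0 from hA ν, ENNReal.toReal_zero]
  have i1 : (P ν).real {n | T ν n ≤ (x : EReal)} ≤
      (P ν).real (Q ν ⁻¹' Set.Iic (x + ε / 2)) + (P ν).real (R ν ⁻¹' Set.Ici K) + (P ν).real (A ν)ᶜ := by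
    refine (measureReal_mono (s₂ := (Q ν ⁻¹' Set.Iic (x + ε / 2) ∪ R ν ⁻¹' Set.Ici K) ∪ (A ν)ᶜ)
      (fun n hn => ?_)).trans ((measureReal_union_le _ _).trans (by gcongr; exact measureReal_union_le _ _))
    by_cases hnA : n ∈ A ν
    · rcases le_total K (R ν n) with hr | hr
      · exact Or.inl (Or.inr hr)
      · obtain ⟨τ, hτ, hτQ⟩ := h4 n hnA hr
        rw [Set.mem_ofPred_eq, hτ, EReal.coe_le_coe_iff] at hn
        refine Or.inl (Or.inl ?_)
        simp only [Set.mem_preimage, Set.mem_Iic]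
        linarith [(abs_lt.1 hτQ).1]
    · exact Or.inr hnA
  have i2 : (P ν).real (Q ν ⁻¹' Set.Iio (x - ε / 4)) ≤ (P ν).real {n | T ν n ≤ (x : EReal)} +
      (P ν).real (R ν ⁻¹' Set.Ici K) + (P ν).real (A ν)ᶜ := by
    refine (measureReal_mono (s₂ := ({n | T ν n ≤ (x : EReal)} ∪ R ν ⁻¹' Set.Ici K) ∪ (A ν)ᶜ)
      (fun n hn => ?_)).trans ((measureReal_union_le _ _).trans (by gcongr; exact measureReal_union_le _ _))
    by_cases hnA : n ∈ A ν
    · rcases le_total K (R ν n) with hr | hr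
      · exact Or.inl (Or.inr hr)
      · obtain ⟨τ, hτ, hτQ⟩ := h4 n hnA hr
        simp only [Set.mem_preimage, Set.mem_Iio] at hn
        refine Or.inl (Or.inl ?_)
        rw [Set.mem_ofPred_eq, hτ, EReal.coe_le_coe_iff]
        linarith [(abs_lt.1 hτQ).2]
    · exact Or.inr hnA
  rw [Real.dist_eq, abs_lt]
  constructor <;> linarith

/-! ### Degrees of freedom -/

section Dimension

variable {k t c r : ℕ} {X : Matrix (Fin k) (Fin t) ℝ} {X0 : Matrix (Fin k) (Fin c) ℝ}
  {C : Matrix (Fin k) (Fin r) ℝ} {mstar : Fin k → ℝ}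

theorem mulVec_injective_of_rank_eq (hX : X.rank = t) : Function.Injective X.mulVec := by
  have h := LinearMap.finrank_range_add_finrank_ker X.mulVecLin
  rw [← Matrix.rank, hX, Module.finrank_fin_fun] at h
  have : Module.finrank ℝ (LinearMap.ker X.mulVecLin) = 0 := by omega
  exact LinearMap.ker_eq_bot.1 (Submodule.finrank_eq_zero.1 this)

theorem range_constraintDeriv_eq_top
    (hreg : (Xᵀ * diagonal mstar * constraintMatrix X0 C).rank = c + r) :
    LinearMap.range (constraintDeriv X (constraintMatrix X0 C) mstar) = ⊤ := by
  refine Submodule.eq_top_of_finrank_eq ?_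
  have h : (constraintMatrix X0 C)ᵀ * diagonal mstar * X =
      (Xᵀ * diagonal mstar * constraintMatrix X0 C)ᵀ := by
    simp [transpose_mul, Matrix.mul_assoc]
  rw [constraintDeriv, ← Matrix.rank, h, rank_transpose, hreg]
  simp

/-- Since `√m* · √m* = m*`, the sampling rows of the linearized constraints factor through `A`;
hence `V ≤ U`, and the sampling constraint inherits surjectivity. -/
theorem samplingConstraint_scaledDesign (hm : ∀ i, 0 < mstar i) (η : Fin t → ℝ) :
    samplingConstraint X0 mstar (scaledDesign X mstar η) =
      fun h => constraintDeriv X (constraintMatrix X0 C) mstar η (Sum.inl h) := by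
  rw [samplingConstraint_apply]
  have h1 : (fun i => √(mstar i) * scaledDesign X mstar η i) = diagonal mstar *ᵥ (X *ᵥ η) := by
    ext i
    rw [scaledDesign_apply, mulVec_diagonal, ← mul_assoc, Real.mul_self_sqrt (hm i).le]
  rw [h1]
  ext h
  simp only [constraintDeriv, mulVecLin_apply, ← mulVec_mulVec, constraintMatrix, transpose_fromCols,
    fromRows_mulVec, Sum.elim_inl]

theorem tangentSpace_le (hm : ∀ i, 0 < mstar i) :
    tangentSpace X (constraintMatrix X0 C) mstar ≤ LinearMap.ker (samplingConstraint X0 mstar) := by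
  rintro _ ⟨η, hη, rfl⟩
  rw [LinearMap.mem_ker, samplingConstraint_scaledDesign (C := C) hm, LinearMap.mem_ker.1 hη]
  rfl

/-- By rank-nullity `dim U = k - c` and `dim V = t - (c + r)`, and `V ≤ U`; `t ≤ k` makes the
truncated subtraction harmless. -/
theorem finrank_normalSpace (hm : ∀ i, 0 < mstar i) (hX : X.rank = t)
    (hreg : (Xᵀ * diagonal mstar * constraintMatrix X0 C).rank = c + r) :
    Module.finrank ℝ ((tangentSpace X (constraintMatrix X0 C) mstar)ᗮ ⊓
      LinearMap.ker (samplingConstraint X0 mstar) : Submodule ℝ (EuclideanSpace ℝ (Fin k))) =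
      k - t + r := by
  have hinj := mulVec_injective_of_rank_eq hX
  have hrange := range_constraintDeriv_eq_top hreg
  have h1 := Submodule.finrank_add_inf_finrank_orthogonal
    (tangentSpace_le (X := X) (X0 := X0) (C := C) hm)
  have h2 : Module.finrank ℝ (tangentSpace X (constraintMatrix X0 C) mstar) =
      Module.finrank ℝ (LinearMap.ker (constraintDeriv X (constraintMatrix X0 C) mstar)) :=
    LinearEquiv.finrank_eq (Submodule.equivMapOfInjective _ (scaledDesign_injective hinj hm) _).symm
  have h3 := LinearMap.finrank_range_add_finrank_ker (constraintDeriv X (constraintMatrix X0 C) mstar)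
  have h4 := LinearMap.finrank_range_add_finrank_ker (samplingConstraint X0 mstar)
  have h5 : LinearMap.range (samplingConstraint X0 mstar) = ⊤ := by
    refine LinearMap.range_eq_top.2 fun y => ?_
    obtain ⟨η, hη⟩ := LinearMap.range_eq_top.1 hrange (Sum.elim y 0)
    refine ⟨scaledDesign X mstar η, ?_⟩
    rw [samplingConstraint_scaledDesign (C := C) hm, hη]
    rfl
  have h6 : t ≤ k := by rw [← hX]; exact X.rank_le_height
  rw [hrange, finrank_top] at h3
  rw [h5, finrank_top] at h4
  simp only [Module.finrank_fintype_fun_eq_card, Fintype.card_sum, Fintype.card_fin,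
    finrank_euclideanSpace] at h3 h4
  omega

theorem stdCount_mem_ker {N : ℝ} (hm : ∀ i, 0 < mstar i) {n : Fin k → ℕ}
    (hn : X0ᵀ *ᵥ realTable n = X0ᵀ *ᵥ (N • mstar)) :
    stdCount mstar N n ∈ LinearMap.ker (samplingConstraint X0 mstar) := by
  rw [LinearMap.mem_ker, samplingConstraint_apply]
  have : (fun i => √(mstar i) * stdCount mstar N n i) = (√N)⁻¹ • (realTable n - N • mstar) := by
    ext i
    have := Real.sqrt_pos.2 (hm i)
    simp only [stdCount, realTable, Pi.smul_apply, Pi.sub_apply, smul_eq_mul]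
    field_simp
  rw [this, mulVec_smul, mulVec_sub, hn, sub_self, smul_zero]

/-- For `w ∈ U` the residual lies in `Vᗮ ⊓ U`, and what it leaves of `w` lies in `V`. -/
theorem sub_starProjection_eq {E : Type*} [NormedAddCommGroup E] [InnerProductSpace ℝ E]
    [FiniteDimensional ℝ E] {V U : Submodule ℝ E} (hVU : V ≤ U) {w : E} (hw : w ∈ U) :
    w - V.starProjection w = (Vᗮ ⊓ U).starProjection w := by
  refine (Submodule.eq_starProjection_of_mem_of_inner_eq_zero (K := Vᗮ ⊓ U)
    ⟨V.sub_starProjection_mem_orthogonal w, U.sub_mem hw (hVU (V.starProjection_apply_mem w))⟩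
    fun y hy => ?_).symm
  rw [sub_sub_cancel]
  exact Submodule.inner_right_of_mem_orthogonal (V.starProjection_apply_mem w) hy.1

end Dimension

end LMLC

/-! ### The limit theorem -/

theorem theorem7
    (k t c r : ℕ)
    -- the design matrix, of full column rank
    (X : Matrix (Fin k) (Fin t) ℝ) (hX : X.rank = t)
    -- the sampling scheme, whose constraint matrix has its column space in that of the design matrix
    (block : 0 < c → Fin k → Fin c) (X0 : Matrix (Fin k) (Fin c) ℝ)
    (hX0 : X0 = LMLC.samplingMatrix block)
    (hX0X : LinearMap.range X0.mulVecLin ≤ LinearMap.range X.mulVecLin)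
    -- the additional linear constraints
    (C : Matrix (Fin k) (Fin r) ℝ)
    -- the fixed normalized mean vector, and the regularity of the model there
    (mstar : Fin k → ℝ)
    (hreg : (Xᵀ * Matrix.diagonal mstar * LMLC.constraintMatrix X0 C).rank = c + r)
    -- the sequence of true models: the expected total grows, the normalized mean stays fixed
    (θ₀ : ℕ → Fin t → ℝ) (N : ℕ → ℝ) (dstar : ℕ → Fin r → ℝ)
    (hN : ∀ ν, N ν = ∑ i, LMLC.meanVec X (θ₀ ν) i)
    (hNtop : Tendsto N atTop atTop)
    (hmstar : ∀ ν, LMLC.meanVec X (θ₀ ν) = N ν • mstar)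
    -- the null hypothesis: the additional constraints hold, and the prefixed totals are the
    -- (integral) expected totals of the subtables
    (hnull : ∀ ν, Cᵀ *ᵥ LMLC.meanVec X (θ₀ ν) = dstar ν)
    (hint : ∀ ν h, ∃ M : ℕ, (X0ᵀ *ᵥ LMLC.meanVec X (θ₀ ν)) h = M)
    -- the divergence functions and the estimators
    (φ₁ φ₂ : ℝ → EReal) (hφ₁ : LMLC.IsPhi φ₁) (hφ₂ : LMLC.IsPhi φ₂)
    (θhat : ℕ → (Fin k → ℕ) → Fin t → ℝ)
    (hθhat : ∀ ν, LMLC.IsMinPhiEstimator φ₂ X X0 C (dstar ν) (θhat ν)) :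
    -- convergence of the distribution functions at every continuity point of the limit
    ∀ x : ℝ, LMLC.chiSquared (k - t + r) {x} = 0 →
      Tendsto
        (fun ν => (LMLC.dataLaw X0 (LMLC.meanVec X (θ₀ ν))).real
          {n | LMLC.testStat φ₁ X n (θhat ν n) ≤ (x : EReal)})
        atTop (𝓝 ((LMLC.chiSquared (k - t + r)).real (Set.Iic x))) := by
  intro x hx
  subst hX0
  have hkpos : 0 < k := by
    obtain ⟨ν, hν⟩ := (hNtop.eventually_gt_atTop 0).exists
    rcases Nat.eq_zero_or_pos k with rfl | h
    · rw [hN] at hν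
      simp at hν
    · exact h
  have hNpos : ∀ ν, 0 < N ν := fun ν => by
    rw [hN]
    exact Finset.sum_pos (fun i _ => LMLC.meanVec_pos X _ i) ⟨⟨0, hkpos⟩, Finset.mem_univ _⟩
  have hm : ∀ i, 0 < mstar i := fun i => by
    have h1 := LMLC.meanVec_pos X (θ₀ 0) i
    rw [hmstar, Pi.smul_apply, smul_eq_mul] at h1
    exact pos_of_mul_pos_right h1 (hNpos 0).le
  set L := LMLC.constraintMatrix (LMLC.samplingMatrix block) C with hL
  set V := LMLC.tangentSpace X L mstar with hV
  set U := LinearMap.ker (LMLC.samplingConstraint (LMLC.samplingMatrix block) mstar) with hU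
  have hVU : V ≤ U := LMLC.tangentSpace_le hm
  have hdim : Module.finrank ℝ (Vᗮ ⊓ U : Submodule ℝ (EuclideanSpace ℝ (Fin k))) = k - t + r :=
    LMLC.finrank_normalSpace hm hX hreg
  simp only [hmstar] at hint ⊢
  have hP : ∀ ν, IsProbabilityMeasure (LMLC.dataLaw (LMLC.samplingMatrix block) (N ν • mstar)) :=
    fun ν => LMLC.isProbabilityMeasure_dataLaw block (fun i => mul_pos (hNpos ν) (hm i)) (hint ν)
  refine LMLC.tendsto_real_of_approx
    (P := fun ν => LMLC.dataLaw (LMLC.samplingMatrix block) (N ν • mstar))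
    (A := fun ν => {n | (LMLC.samplingMatrix block)ᵀ *ᵥ LMLC.realTable n =
      (LMLC.samplingMatrix block)ᵀ *ᵥ (N ν • mstar)})
    (T := fun ν n => LMLC.testStat φ₁ X n (θhat ν n))
    (fun ν => ae_cond_mem (Set.to_countable _).measurableSet)
    -- The central limit theorem is used twice: on `Vᗮ ⊓ U` for the limit law, and on `U` for
    -- tightness.
    (LMLC.tendsto_map_norm_sq_proj block hm hNtop hint hP inf_le_right hdim)
    (LMLC.tendsto_map_norm_sq_proj block hm hNtop hint hP (W := U) le_rfl rfl) ?_ hx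
  intro K ε hε
  -- the index set of the tables that satisfy the sampling constraints and are not too far off
  let ι := {p : ℕ × (Fin k → ℕ) // (LMLC.samplingMatrix block)ᵀ *ᵥ LMLC.realTable p.2 = (LMLC.samplingMatrix block)ᵀ *ᵥ (N p.1 • mstar) ∧
    ‖U.starProjection (LMLC.stdCount mstar (N p.1) p.2)‖ ^ 2 ≤ K}
  -- Eventually along this filter means: for all large `ν`, simultaneously for all admissible
  -- tables. Sequential asymptotics thereby become uniform in the table.
  let l : Filter ι := comap (fun p => p.1.1) atTop
  have hmemU : ∀ p : ι, LMLC.stdCount mstar (N p.1.1) p.1.2 ∈ U := fun p =>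
    LMLC.stdCount_mem_ker hm p.2.1
  have hw : (fun p : ι => LMLC.stdCount mstar (N p.1.1) p.1.2) =O[l] fun _ => (1 : ℝ) := by
    refine IsBigO.of_bound (√K) (Eventually.of_forall fun p => ?_)
    have h1 := p.2.2
    rw [Submodule.starProjection_eq_self_iff.2 (hmemU p)] at h1
    rw [norm_one, mul_one]
    exact Real.le_sqrt_of_sq_le h1
  obtain ⟨T, hT, hTQ⟩ := LMLC.exists_testStat_tendsto (l := l) (X := X) (L := L)
    (N := fun p : ι => N p.1.1) (θ₀ := fun p => θ₀ p.1.1) (n := fun p => p.1.2)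
    (θhat := fun p => θhat p.1.1 p.1.2)
    (Θ := fun p => LMLC.paramSpace X (LMLC.samplingMatrix block) C (dstar p.1.1) p.1.2) hφ₁ hφ₂
    (LMLC.mulVec_injective_of_rank_eq hX) hm (LMLC.range_constraintDeriv_eq_top hreg)
    (hNtop.comp tendsto_comap) (fun p => hmstar _) hw
    (fun p i => by
      have h1 := Real.sqrt_pos.2 (hNpos p.1.1)
      have h2 := Real.sqrt_pos.2 (hm i)
      simp only [LMLC.stdCount, LMLC.realTable]
      field_simp
      ring)
    -- Admissible tables have the expected totals, so the right-hand side `d` equals `Lᵀ m(θ₀)` and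
    -- `θ₀` is feasible.
    (fun p => by
      rw [LMLC.paramSpace, p.2.1, ← hnull, ← hmstar]
      ext θ
      rw [Set.mem_ofPred_eq, Set.mem_ofPred_eq, hL, LMLC.constraintMatrix, transpose_fromCols,
        fromRows_mulVec, fromRows_mulVec])
    (fun p => hθhat p.1.1 p.1.2)
  have hev := hT.and (Metric.tendsto_nhds.1 hTQ ε hε)
  rw [eventually_comap] at hev
  filter_upwards [hev] with ν hν n hnA hnK
  obtain ⟨h1, h2⟩ := hν ⟨(ν, n), hnA, hnK⟩ rfl
  refine ⟨_, h1, ?_⟩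
  rw [Real.dist_eq, sub_zero, LMLC.sub_starProjection_eq hVU (hmemU ⟨(ν, n), hnA, hnK⟩)] at h2
  exact h2
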